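/- For $C^*$-algebras $A,B$, an associative Hilbert $C^*$-bimodule $M$ (left over $A$, right over $B$) is a Banach space which is an $A$-$B$-bimodule with nondegenerate actions, a left Hilbert $C^*$-module over $A$ with inner product ${}_A\langle\cdot,\cdot\rangle$ and a right Hilbert $C^*$-module over $B$ with inner product $\langle\cdot,\cdot\rangle_B$, such that $\langle am,n\rangle_B=\langle m,a^*n\rangle_B$, ${}_A\langle mb,n\rangle={}_A\langle m,nb^*\rangle$, ${}_A\langle m,n\rangle r=m\langle n,r\rangle_B$, and the norm of $M$ is equivalent to $\|{}_A\langle m,m\rangle\|^{1/2}$ and to $\|\langle m,m\rangle_B\|^{1/2}$. It is full, or an $A$-$B$-imprimitivity bimodule, if the linear spans of the values of the two inner products are dense in $A$ and in $B$; $A$ and $B$ are strongly Morita equivalent if an $A$-$B$-imprimitivity bimodule exists. Isomorphisms preserve both actions and both inner products. The dual $M^*$ is the conjugate space of $M$ with $b\tilde m=(mb^*)^{\sim}$, $\tilde m a=(a^*m)^{\sim}$, ${}_B\langle\tilde m,\tilde n\rangle=\langle m,n\rangle_B$, $\langle\tilde m,\tilde n\rangle_A={}_A\langle m,n\rangle$.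 Let $S(A)$ be the semigroup of isomorphism classes of associative Hilbert $C^*$-bimodules over $A$ on both sides, with product $[M][N]=[M\otimes_A N]$ (the completed interior tensor product, with $\langle m\otimes n,m'\otimes n'\rangle_A=\langle n,\langle m,m'\rangle_A n'\rangle_A$ and ${}_A\langle m\otimes n,m'\otimes n'\rangle={}_A\langle m\,{}_A\langle n,n'\rangle,m'\rangle$), and with $[M]^{-1}:=[M^*]$ (this is the inverse operation of $S(A)$ as an inverse semigroup). Let $A$ and $B$ be strongly Morita equivalent $C^*$-algebras. Then $S(A)\cong S(B)$. Moreover, for every $A$-$B$-imprimitivity bimodule $M$, the map $[Q]\mapsto[M^*\otimes_A Q\otimes_A M]$ is a well-defined isomorphism of semigroups $S(A)\to S(B)$ which commutes with $[\,\cdot\,]\mapsto[\,\cdot\,]^{-1}$, and its inverse is $[P]\mapsto[M\otimes_B P\otimes_B M^*]$. -/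

import Mathlib

open scoped TensorProduct ComplexConjugate ComplexOrder

universe u

/-- The algebraic part of a Hilbert `A`-`B`-bimodule: a complex vector space `V` with commuting
left `A`-action and right `B`-action (`rsmul b x` is `x b`), an `A`-valued form `linner`, linear in
the first variable, and a `B`-valued form `rinner`, linear in the second variable, both positive
semidefinite, such that each algebra acts by adjointable operators for the other form. -/
structure PreHilbertBimodule (A B : Type u) [NonUnitalCStarAlgebra A] [NonUnitalCStarAlgebra B]
    (V : Type u) [AddCommGroup V] [Module ℂ V] where
  lsmul : A →ₗ[ℂ] V →ₗ[ℂ] V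
  rsmul : B →ₗ[ℂ] V →ₗ[ℂ] V
  linner : V →ₗ[ℂ] V →ₗ⋆[ℂ] A
  rinner : V →ₗ⋆[ℂ] V →ₗ[ℂ] B
  mul_lsmul : ∀ a a' x, lsmul (a * a') x = lsmul a (lsmul a' x)
  mul_rsmul : ∀ b b' x, rsmul (b * b') x = rsmul b' (rsmul b x)
  lsmul_rsmul : ∀ a b x, rsmul b (lsmul a x) = lsmul a (rsmul b x)
  linner_lsmul : ∀ a x y, linner (lsmul a x) y = a * linner x y
  rinner_rsmul : ∀ b x y, rinner x (rsmul b y) = rinner x y * b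
  star_linner : ∀ x y, star (linner x y) = linner y x
  star_rinner : ∀ x y, star (rinner x y) = rinner y x
  linner_nonneg : ∀ x, ∃ a, linner x x = star a * a
  rinner_nonneg : ∀ x, ∃ b, rinner x x = star b * b
  rinner_lsmul : ∀ a x y, rinner (lsmul a x) y = rinner x (lsmul (star a) y)
  linner_rsmul : ∀ b x y, linner (rsmul b x) y = linner x (rsmul (star b) y)

/-- An associative Hilbert C*-bimodule, left over `A` and right over `B`, not necessarily full:
a Banach space with two nondegenerate actions and two definite inner products whose norms are
equivalent to the given one, and `⟨x, y⟩_A z = x ⟨y, z⟩_B`. -/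
structure HilbertBimodule (A B : Type u) [NonUnitalCStarAlgebra A] [NonUnitalCStarAlgebra B] where
  carrier : Type u
  [normedAddCommGroup : NormedAddCommGroup carrier]
  [normedSpace : NormedSpace ℂ carrier]
  [completeSpace : CompleteSpace carrier]
  toPre : PreHilbertBimodule A B carrier
  dense_lsmul : Dense (Submodule.span ℂ {z | ∃ a x, z = toPre.lsmul a x} : Set carrier)
  dense_rsmul : Dense (Submodule.span ℂ {z | ∃ b x, z = toPre.rsmul b x} : Set carrier)
  linner_definite : ∀ x, toPre.linner x x = 0 → x = 0
  rinner_definite : ∀ x, toPre.rinner x x = 0 → x = 0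
  lnorm_equiv : ∃ c > 0, ∃ C > 0, ∀ x,
    c * ‖x‖ ≤ √‖toPre.linner x x‖ ∧ √‖toPre.linner x x‖ ≤ C * ‖x‖
  rnorm_equiv : ∃ c > 0, ∃ C > 0, ∀ x,
    c * ‖x‖ ≤ √‖toPre.rinner x x‖ ∧ √‖toPre.rinner x x‖ ≤ C * ‖x‖
  assoc : ∀ x y z, toPre.lsmul (toPre.linner x y) z = toPre.rsmul (toPre.rinner y z) x

attribute [instance] HilbertBimodule.normedAddCommGroup HilbertBimodule.normedSpace
  HilbertBimodule.completeSpace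

/-- The complex conjugate of a complex vector space: the same set, with scalar multiplication
`z • x` given by `conj z • x`. -/
def ConjSpace (V : Type u) : Type u := V

namespace ConjSpace

variable {V : Type u}

instance [AddCommGroup V] : AddCommGroup (ConjSpace V) := inferInstanceAs (AddCommGroup V)

noncomputable instance [AddCommGroup V] [Module ℂ V] : Module ℂ (ConjSpace V) :=
  Module.compHom V (starRingEnd ℂ)

instance [NormedAddCommGroup V] : NormedAddCommGroup (ConjSpace V) :=
  inferInstanceAs (NormedAddCommGroup V)

noncomputable instance [NormedAddCommGroup V] [NormedSpace ℂ V] : NormedSpace ℂ (ConjSpace V) where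
  norm_smul_le z x := by
    change ‖(starRingEnd ℂ z • (show V from x) : V)‖ ≤ ‖z‖ * ‖(show V from x)‖
    rw [norm_smul, RCLike.norm_conj]

instance [NormedAddCommGroup V] [CompleteSpace V] : CompleteSpace (ConjSpace V) :=
  inferInstanceAs (CompleteSpace V)

/-- The identity map onto the conjugate space, a conjugate linear bijection. -/
noncomputable def toConj [AddCommGroup V] [Module ℂ V] : V ≃ₗ⋆[ℂ] ConjSpace V where
  toFun x := x
  invFun x := x
  map_add' _ _ := rfl
  map_smul' z x := by
    change z • (show V from x) = (starRingEnd ℂ (starRingEnd ℂ z)) • (show V from x)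
    simp
  left_inv _ := rfl
  right_inv _ := rfl

@[simp]
lemma toConj_smul [AddCommGroup V] [Module ℂ V] (z : ℂ) (x : V) :
    toConj (z • x) = conj z • toConj x := toConj.map_smulₛₗ z x

@[simp]
lemma toConj_symm_smul [AddCommGroup V] [Module ℂ V] (z : ℂ) (x : ConjSpace V) :
    toConj.symm (z • x) = conj z • toConj.symm x := toConj.symm.map_smulₛₗ z x

end ConjSpace

namespace PreHilbertBimodule

variable {A B C : Type u} [NonUnitalCStarAlgebra A] [NonUnitalCStarAlgebra B]
  [NonUnitalCStarAlgebra C] {V : Type u} [AddCommGroup V] [Module ℂ V]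

open ConjSpace

/-- The dual bimodule on the conjugate space: `b x~ = (x b*)~`, `x~ a = (a* x)~`,
`⟨x~, y~⟩_B = ⟨x, y⟩_B` as left form, `⟨x~, y~⟩_A = ⟨x, y⟩_A` as right form. -/
noncomputable def dual (p : PreHilbertBimodule A B V) :
    PreHilbertBimodule B A (ConjSpace V) where
  lsmul := LinearMap.mk₂ ℂ (fun b x => toConj (p.rsmul (star b) (toConj.symm x)))
    (by simp) (by simp) (by simp) (by simp)
  rsmul := LinearMap.mk₂ ℂ (fun a x => toConj (p.lsmul (star a) (toConj.symm x)))
    (by simp) (by simp) (by simp) (by simp)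
  linner := LinearMap.mk₂'ₛₗ (RingHom.id ℂ) (starRingEnd ℂ)
    (fun x y => p.rinner (toConj.symm x) (toConj.symm y))
    (by simp) (by simp) (by simp) (by simp)
  rinner := LinearMap.mk₂'ₛₗ (starRingEnd ℂ) (RingHom.id ℂ)
    (fun x y => p.linner (toConj.symm x) (toConj.symm y))
    (by simp) (by simp) (by simp) (by simp)
  mul_lsmul := by simp [p.mul_rsmul]
  mul_rsmul := by simp [p.mul_lsmul]
  lsmul_rsmul := by simp [p.lsmul_rsmul]
  linner_lsmul b x y := by
    simp only [LinearMap.mk₂_apply, LinearMap.mk₂'ₛₗ_apply, LinearEquiv.symm_apply_apply]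
    rw [← p.star_rinner, p.rinner_rsmul, star_mul, p.star_rinner, star_star]
  rinner_rsmul a x y := by
    simp only [LinearMap.mk₂_apply, LinearMap.mk₂'ₛₗ_apply, LinearEquiv.symm_apply_apply]
    rw [← p.star_linner, p.linner_lsmul, star_mul, p.star_linner, star_star]
  star_linner _ _ := p.star_rinner _ _
  star_rinner _ _ := p.star_linner _ _
  linner_nonneg _ := p.rinner_nonneg _
  rinner_nonneg _ := p.linner_nonneg _
  rinner_lsmul b x y := by
    simp [p.linner_rsmul]
  linner_rsmul a x y := by
    simp [p.rinner_lsmul]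

end PreHilbertBimodule

section Order

attribute [local instance] CStarAlgebra.spectralOrder CStarAlgebra.spectralOrderedRing

lemma exists_real_approx {δ : ℝ} (hδ : 0 < δ) : ∃ q : ℝ → ℝ, Continuous q ∧ q 0 = 0 ∧
    ∀ t, 0 ≤ t → ‖t * (1 - q t * t * q t) ^ 2‖ ≤ δ := by
  have hpos : ∀ t : ℝ, 0 < |t| ^ 3 + δ ^ 3 := fun t => by positivity
  refine ⟨fun t => t / √(|t| ^ 3 + δ ^ 3), ?_, by simp, fun t ht0 => ?_⟩
  · refine continuous_id.div (by fun_prop) fun t => ?_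
    exact (Real.sqrt_pos.mpr (hpos t)).ne'
  · have hP : 0 < t ^ 3 + δ ^ 3 := by positivity
    have hq2 : t / √(|t| ^ 3 + δ ^ 3) * t * (t / √(|t| ^ 3 + δ ^ 3))
        = t ^ 3 / (t ^ 3 + δ ^ 3) := by
      rw [abs_of_nonneg ht0, div_mul_eq_mul_div, div_mul_div_comm, Real.mul_self_sqrt hP.le]
      ring
    have h1q : 1 - t / √(|t| ^ 3 + δ ^ 3) * t * (t / √(|t| ^ 3 + δ ^ 3))
        = δ ^ 3 / (t ^ 3 + δ ^ 3) := by
      rw [hq2]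
      field_simp
      ring
    simp only [h1q]
    rw [Real.norm_of_nonneg (by positivity), div_pow, mul_div_assoc', div_le_iff₀ (by positivity)]
    rcases le_total t δ with htd | htd
    · have : (δ ^ 3) ^ 2 ≤ (t ^ 3 + δ ^ 3) ^ 2 := by gcongr; linarith [pow_nonneg ht0 3]
      exact mul_le_mul htd this (by positivity) hδ.le
    · have h5 : δ ^ 5 ≤ t ^ 5 := by gcongr
      have h6 : t ^ 6 ≤ (t ^ 3 + δ ^ 3) ^ 2 := by
        calc t ^ 6 = (t ^ 3) ^ 2 := by ring
          _ ≤ _ := by gcongr; linarith [pow_pos hδ 3]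
      calc t * (δ ^ 3) ^ 2 = δ * (t * δ ^ 5) := by ring
        _ ≤ δ * (t * t ^ 5) := by gcongr
        _ = δ * t ^ 6 := by ring
        _ ≤ _ := by gcongr

lemma exists_selfAdjoint_approx {A : Type u} [NonUnitalCStarAlgebra A] {h : A} (h0 : 0 ≤ h)
    {δ : ℝ} (hδ : 0 < δ) : ∃ d : A, star d = d ∧
      ‖h - d * h * d * h - h * (d * h * d) + d * h * d * h * (d * h * d)‖ ≤ δ := by
  obtain ⟨q, hq, hq0, hqb⟩ := exists_real_approx hδ
  have hsa : IsSelfAdjoint h := h0.isSelfAdjoint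
  let f : ℝ → ℝ := fun t => q t * t * q t
  have hf : Continuous f := by fun_prop
  have hf0 : f 0 = 0 := by simp [f]
  have he : cfcₙ f h = cfcₙ q h * h * cfcₙ q h := by
    have h1 : cfcₙ (fun t => q t * t) h = cfcₙ q h * h := by
      rw [cfcₙ_mul q (fun t => t) h hq.continuousOn hq0, cfcₙ_id' ℝ h]
    rw [← h1]
    exact cfcₙ_mul (fun t => q t * t) q h (by fun_prop) (by simp) hq.continuousOn hq0
  refine ⟨cfcₙ q h, (cfcₙ_predicate q h : IsSelfAdjoint _), ?_⟩
  rw [← he]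
  have hfb : ∀ t, 0 ≤ t → ‖t - f t * t - t * f t + f t * t * f t‖ ≤ δ := by
    intro t ht
    have h1 : t - f t * t - t * f t + f t * t * f t = t * (1 - q t * t * q t) ^ 2 := by
      simp only [f]
      ring
    rw [h1]
    exact hqb t ht
  clear_value f
  have h1 : cfcₙ (fun t => f t * t) h = cfcₙ f h * h := by
    rw [cfcₙ_mul f (fun t => t) h hf.continuousOn hf0, cfcₙ_id' ℝ h]
  have h2 : cfcₙ (fun t => t * f t) h = h * cfcₙ f h := by
    rw [cfcₙ_mul (fun t => t) f h (by fun_prop) rfl hf.continuousOn hf0, cfcₙ_id' ℝ h]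
  have h3 : cfcₙ (fun t => f t * t * f t) h = cfcₙ f h * h * cfcₙ f h := by
    rw [← h1]
    exact cfcₙ_mul (fun t => f t * t) f h (by fun_prop) (by simp) hf.continuousOn hf0
  have h4 : cfcₙ (fun t => t - f t * t) h = h - cfcₙ f h * h := by
    rw [← h1, cfcₙ_sub (fun t => t) (fun t => f t * t) h (by fun_prop) rfl (by fun_prop) (by simp),
      cfcₙ_id' ℝ h]
  have h5 : cfcₙ (fun t => t - f t * t - t * f t) h = h - cfcₙ f h * h - h * cfcₙ f h := by
    rw [← h4, ← h2]
    exact cfcₙ_sub (fun t => t - f t * t) (fun t => t * f t) h (by fun_prop) (by simp)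
      (by fun_prop) (by simp)
  rw [← h5, ← h3, ← cfcₙ_add (fun t => t - f t * t - t * f t) (fun t => f t * t * f t) h
    (by fun_prop) (by simp) (by fun_prop) (by simp)]
  refine norm_cfcₙ_le fun t ht => ?_
  exact hfb t (quasispectrum_nonneg_of_nonneg h h0 t ht)

namespace PreHilbertBimodule

variable {A B C : Type u} [NonUnitalCStarAlgebra A] [NonUnitalCStarAlgebra B]
  [NonUnitalCStarAlgebra C] {V : Type u} [AddCommGroup V] [Module ℂ V]
  (p : PreHilbertBimodule A B V)

lemma rinner_self_nonneg (x : V) : 0 ≤ p.rinner x x := by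
  obtain ⟨b, hb⟩ := p.rinner_nonneg x
  rw [hb]
  exact star_mul_self_nonneg b

lemma linner_self_nonneg (x : V) : 0 ≤ p.linner x x := by
  obtain ⟨b, hb⟩ := p.linner_nonneg x
  rw [hb]
  exact star_mul_self_nonneg b

lemma exists_star_mul_self {a : A} (h : 0 ≤ a) : ∃ b, a = star b * b :=
  CStarAlgebra.nonneg_iff_eq_star_mul_self.mp h

lemma rinner_rsmul_left (b : B) (x y : V) : p.rinner (p.rsmul b x) y = star b * p.rinner x y := by
  rw [← p.star_rinner, p.rinner_rsmul, star_mul, p.star_rinner]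

lemma linner_lsmul_right (a : A) (x y : V) : p.linner x (p.lsmul a y) = p.linner x y * star a := by
  rw [← p.star_linner, p.linner_lsmul, star_mul, p.star_linner]

lemma rinner_cauchy (x y : V) :
    ‖p.rinner x y‖ ^ 2 ≤ ‖p.rinner x x‖ * ‖p.rinner y y‖ := by
  set c := p.rinner x y with hc
  have hc' : p.rinner y x = star c := (p.star_rinner x y).symm
  have key : ∀ r : ℝ, ‖p.rinner x x‖ < r → ‖c‖ ^ 2 ≤ r * ‖p.rinner y y‖ := by
    intro r hr
    have r0 : 0 < r := (norm_nonneg _).trans_lt hr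
    have h1 : 0 ≤ p.rinner (p.rsmul c x - (r : ℂ) • y) (p.rsmul c x - (r : ℂ) • y) :=
      p.rinner_self_nonneg _
    have h2 : p.rinner (p.rsmul c x - (r : ℂ) • y) (p.rsmul c x - (r : ℂ) • y)
        = star c * p.rinner x x * c - (2 * r) • (star c * c) + (r ^ 2) • p.rinner y y := by
      simp only [map_sub, LinearMap.sub_apply, p.rinner_rsmul_left, p.rinner_rsmul,
        map_smulₛₗ, LinearMap.smul_apply, hc', RingHom.id_apply, Complex.conj_ofReal,
        mul_assoc, smul_sub]
      rw [← hc]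
      simp only [Complex.coe_smul]
      module
    have h3 : star c * p.rinner x x * c ≤ r • (star c * c) := by
      refine (CStarAlgebra.star_left_conjugate_le_norm_smul
        (hb := (p.rinner_self_nonneg x).isSelfAdjoint)).trans ?_
      exact smul_le_smul_of_nonneg_right hr.le (star_mul_self_nonneg c)
    have h4 : r • (star c * c) ≤ (r ^ 2) • p.rinner y y := by
      rw [h2] at h1
      have h5 := h1.trans (add_le_add_left (sub_le_sub_right h3 _) _)
      have h6 : r • (star c * c) - (2 * r) • (star c * c) + r ^ 2 • p.rinner y y
        = r ^ 2 • p.rinner y y - r • (star c * c) := by module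
      rw [h6] at h5
      exact sub_nonneg.mp h5
    have h7 := CStarAlgebra.norm_le_norm_of_nonneg_of_le
      (smul_nonneg r0.le (star_mul_self_nonneg c)) h4
    rw [norm_smul, norm_smul, CStarRing.norm_star_mul_self, Real.norm_of_nonneg r0.le,
      Real.norm_of_nonneg (by positivity)] at h7
    have : r * ‖c‖ ^ 2 ≤ r * (r * ‖p.rinner y y‖) := by nlinarith
    exact le_of_mul_le_mul_left this r0
  refine le_of_forall_pos_le_add fun ε hε => ?_
  have hY := norm_nonneg (p.rinner y y)
  have := key (‖p.rinner x x‖ + ε / (‖p.rinner y y‖ + 1)) (by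
    have : 0 < ε / (‖p.rinner y y‖ + 1) := by positivity
    linarith)
  have h8 : ε / (‖p.rinner y y‖ + 1) * ‖p.rinner y y‖ ≤ ε := by
    rw [div_mul_eq_mul_div, div_le_iff₀ (by positivity)]
    nlinarith
  nlinarith

/-- The two inner products are compatible up to null vectors. -/
def WeakAssoc : Prop :=
  (∀ w x y z, p.rinner w (p.lsmul (p.linner x y) z) = p.rinner w x * p.rinner y z) ∧
  (∀ w x y z, p.linner (p.rsmul (p.rinner y z) x) w = p.linner x y * p.linner z w)

lemma rinner_lsmul_bound (x : V) : ∃ K : ℝ, ∀ a, ‖p.rinner x (p.lsmul a x)‖ ≤ K * ‖a‖ := by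
  let φ : A →ₗ[ℂ] B := (p.rinner x).comp (p.lsmul.flip x)
  let ψ : A →ₚ[ℂ] B := PositiveLinearMap.mk₀ φ (by
    intro a ha
    obtain ⟨d, rfl⟩ := exists_star_mul_self ha
    change 0 ≤ p.rinner x (p.lsmul (star d * d) x)
    rw [p.mul_lsmul, ← p.rinner_lsmul]
    exact p.rinner_self_nonneg _)
  obtain ⟨K, hK⟩ := PositiveLinearMap.exists_norm_apply_le ψ
  exact ⟨K, hK⟩

lemma norm_rinner_le_linner (h : p.WeakAssoc) (x : V) :
    ‖p.rinner x x‖ ≤ ‖p.linner x x‖ := by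
  set c := p.rinner x x with hc
  set a := p.linner x x with ha
  have hcs : star c = c := p.star_rinner x x
  have has : star a = a := p.star_linner x x
  obtain ⟨K, hK⟩ := p.rinner_lsmul_bound x
  -- repeated squares of `a` and `c`
  obtain ⟨t, t0, t1⟩ : ∃ t : ℕ → A, t 0 = a ∧ ∀ k, t (k + 1) = t k * t k :=
    ⟨fun k => Nat.rec a (fun _ y => y * y) k, rfl, fun _ => rfl⟩
  obtain ⟨s, s0, s1⟩ : ∃ s : ℕ → B, s 0 = c ∧ ∀ k, s (k + 1) = s k * s k :=
    ⟨fun k => Nat.rec c (fun _ y => y * y) k, rfl, fun _ => rfl⟩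
  have ts : ∀ k, star (t k) = t k := by
    intro k
    induction k with
    | zero => rw [t0, has]
    | succ k ih => rw [t1, star_mul, ih]
  have ss : ∀ k, star (s k) = s k := by
    intro k
    induction k with
    | zero => rw [s0, hcs]
    | succ k ih => rw [s1, star_mul, ih]
  have tn : ∀ k, ‖t k‖ = ‖a‖ ^ 2 ^ k := by
    intro k
    induction k with
    | zero => simp [t0]
    | succ k ih =>
      rw [t1]
      nth_rewrite 1 [← ts k]
      rw [CStarRing.norm_star_mul_self, ih]
      ring
  have sn : ∀ k, ‖s k‖ = ‖c‖ ^ 2 ^ k := by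
    intro k
    induction k with
    | zero => simp [s0]
    | succ k ih =>
      rw [s1]
      nth_rewrite 1 [← ss k]
      rw [CStarRing.norm_star_mul_self, ih]
      ring
  have key : ∀ k w, p.rinner w (p.lsmul (t k) x) = p.rinner w x * s k := by
    intro k
    induction k with
    | zero => intro w; rw [t0, s0]; exact h.1 w x x x
    | succ k ih =>
      intro w
      rw [t1, s1, p.mul_lsmul]
      nth_rewrite 1 [← ts k]
      rw [← p.rinner_lsmul, ih, p.rinner_lsmul, ts k, ih, mul_assoc]
  have hr : ∀ k, ∃ r, s (k + 1) = c * r ∧ ‖r‖ * ‖c‖ ≤ ‖c‖ ^ 2 ^ (k + 1) := by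
    intro k
    induction k with
    | zero => exact ⟨c, by rw [s1, s0], le_of_eq (by ring)⟩
    | succ k ih =>
      obtain ⟨r, h1, h2⟩ := ih
      refine ⟨r * s (k + 1), by rw [s1, ← mul_assoc, ← h1], ?_⟩
      have := norm_mul_le r (s (k + 1))
      rw [sn] at this
      calc _ ≤ (‖r‖ * ‖c‖ ^ 2 ^ (k + 1)) * ‖c‖ := by gcongr
        _ = (‖r‖ * ‖c‖) * ‖c‖ ^ 2 ^ (k + 1) := by ring
        _ ≤ ‖c‖ ^ 2 ^ (k + 1) * ‖c‖ ^ 2 ^ (k + 1) := by gcongr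
        _ = _ := by ring
  by_contra! hlt
  have c0 : 0 < ‖c‖ := (norm_nonneg _).trans_lt hlt
  have bound : ∀ k : ℕ, ‖c‖ * ‖c‖ ^ 2 ^ (k + 1) ≤ K * ‖a‖ ^ 2 ^ (k + 1) := by
    intro k
    obtain ⟨r, h1, h2⟩ := hr k
    have h3 : ‖c * s (k + 1)‖ ≤ K * ‖a‖ ^ 2 ^ (k + 1) := by
      rw [hc, ← key, ← tn]
      exact hK _
    have h4 : ‖c‖ ^ 2 ^ (k + 1) * ‖c‖ ^ 2 ^ (k + 1) ≤ ‖c * s (k + 1)‖ * ‖r‖ := by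
      have : s (k + 2) = star (c * s (k + 1)) * r := by
        rw [s1 (k + 1), star_mul, ss (k + 1), hcs, mul_assoc, ← h1]
      have h5 := norm_mul_le (star (c * s (k + 1))) r
      rw [← this, sn, norm_star] at h5
      calc _ = ‖c‖ ^ 2 ^ (k + 2) := by ring
        _ ≤ _ := h5
    have h6 : ‖c‖ ^ 2 ^ (k + 1) * (‖c‖ * ‖c‖ ^ 2 ^ (k + 1))
        ≤ ‖c‖ ^ 2 ^ (k + 1) * ‖c * s (k + 1)‖ := by
      calc _ = (‖c‖ ^ 2 ^ (k + 1) * ‖c‖ ^ 2 ^ (k + 1)) * ‖c‖ := by ring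
        _ ≤ (‖c * s (k + 1)‖ * ‖r‖) * ‖c‖ := by gcongr
        _ = (‖r‖ * ‖c‖) * ‖c * s (k + 1)‖ := by ring
        _ ≤ _ := by gcongr
    exact (le_of_mul_le_mul_left h6 (by positivity)).trans h3
  have lim : Filter.Tendsto (fun k : ℕ => K * (‖a‖ / ‖c‖) ^ 2 ^ (k + 1)) Filter.atTop
      (nhds (K * 0)) := by
    refine Filter.Tendsto.const_mul K ?_
    have h1 : Filter.Tendsto (fun n : ℕ => (‖a‖ / ‖c‖) ^ n) Filter.atTop (nhds 0) :=
      tendsto_pow_atTop_nhds_zero_of_lt_one (by positivity) ((div_lt_one c0).mpr hlt)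
    refine h1.comp ?_
    exact (tendsto_pow_atTop_atTop_of_one_lt (by norm_num : (1 : ℕ) < 2)).comp
      (Filter.tendsto_add_atTop_nat 1)
  have : ‖c‖ ≤ K * 0 := by
    refine ge_of_tendsto' lim fun k => ?_
    rw [div_pow, mul_div_assoc', le_div_iff₀ (by positivity)]
    exact bound k
  linarith

variable {p} in
lemma WeakAssoc.dual (h : p.WeakAssoc) : p.dual.WeakAssoc := by
  have h1 : ∀ w x y z : V,
      p.linner w (p.rsmul (star (p.rinner x y)) z) = p.linner w x * p.linner y z := by
    intro w x y z
    rw [p.star_rinner, ← p.star_linner, h.2, star_mul, p.star_linner, p.star_linner]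
  have h2 : ∀ w x y z : V,
      p.rinner (p.lsmul (star (p.linner y z)) x) w = p.rinner x y * p.rinner z w := by
    intro w x y z
    rw [p.star_linner, ← p.star_rinner, h.1, star_mul, p.star_rinner, p.star_rinner]
  exact ⟨h1, h2⟩

lemma norm_linner_eq_rinner (h : p.WeakAssoc) (x : V) :
    ‖p.linner x x‖ = ‖p.rinner x x‖ :=
  le_antisymm (p.dual.norm_rinner_le_linner h.dual x) (p.norm_rinner_le_linner h x)

lemma linner_cauchy (x y : V) :
    ‖p.linner x y‖ ^ 2 ≤ ‖p.linner x x‖ * ‖p.linner y y‖ := p.dual.rinner_cauchy x y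

/-- Elements are approximated by their multiples under suitable elements of `A`. -/
lemma exists_approx {ι : Type*} (s : Finset ι) (m : ι → V) :
    ∃ d : ℕ → A, (∀ k, star (d k) = d k) ∧ ∀ j ∈ s, Filter.Tendsto
      (fun k => ‖p.linner
        (m j - p.lsmul (d k * (∑ i ∈ s, p.linner (m i) (m i)) * d k) (m j))
        (m j - p.lsmul (d k * (∑ i ∈ s, p.linner (m i) (m i)) * d k) (m j))‖)
      Filter.atTop (nhds 0) := by
  set h := ∑ i ∈ s, p.linner (m i) (m i) with hh
  have h0 : 0 ≤ h := Finset.sum_nonneg fun i _ => p.linner_self_nonneg _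
  have hsa : IsSelfAdjoint h := h0.isSelfAdjoint
  have hle : ∀ j ∈ s, p.linner (m j) (m j) ≤ h := fun j hj =>
    Finset.single_le_sum (f := fun i => p.linner (m i) (m i))
      (fun i _ => p.linner_self_nonneg _) hj
  have key : ∀ δ : ℝ, 0 < δ → ∃ d : A, star d = d ∧ ∀ j ∈ s, ‖p.linner
        (m j - p.lsmul (d * h * d) (m j)) (m j - p.lsmul (d * h * d) (m j))‖ ≤ δ := by
    intro δ hδ
    obtain ⟨d, hds, hd⟩ := exists_selfAdjoint_approx h0 hδ
    set e := d * h * d with he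
    have hes : star e = e := by
      rw [he, star_mul, star_mul, hds, hsa.star_eq, mul_assoc]
    refine ⟨d, hds, fun j hj => ?_⟩
    set g := p.linner (m j) (m j) with hg
    have h1 : p.linner (m j - p.lsmul e (m j)) (m j - p.lsmul e (m j))
        = g - e * g - g * e + e * g * e := by
      simp only [map_sub, LinearMap.sub_apply, p.linner_lsmul, p.linner_lsmul_right, hes, mul_assoc]
      rw [← hg]
      abel
    have h2 : g - e * g - g * e + e * g * e ≤ h - e * h - h * e + e * h * e := by
      obtain ⟨f, hf⟩ := exists_star_mul_self (sub_nonneg.mpr (hle j hj))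
      rw [← sub_nonneg]
      have : h - e * h - h * e + e * h * e - (g - e * g - g * e + e * g * e)
          = star (f - f * e) * (f - f * e) := by
        have h3 : star (f - f * e) * (f - f * e)
          = star f * f - e * (star f * f) - (star f * f) * e + e * (star f * f) * e := by
          rw [star_sub, star_mul, hes]
          noncomm_ring
        rw [h3, ← hf]
        noncomm_ring
      rw [this]
      exact star_mul_self_nonneg _
    refine (CStarAlgebra.norm_le_norm_of_nonneg_of_le (p.linner_self_nonneg _)
      (h1.le.trans h2)).trans ?_
    exact hd
  choose d hd using fun k : ℕ => key (1 / ((k : ℝ) + 1)) (by positivity)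
  refine ⟨d, fun k => (hd k).1, fun j hj => ?_⟩
  exact squeeze_zero (fun _ => norm_nonneg _) (fun k => (hd k).2 j hj)
    tendsto_one_div_add_atTop_nhds_zero_nat

end PreHilbertBimodule
end Order

section Order

attribute [local instance] CStarAlgebra.spectralOrder CStarAlgebra.spectralOrderedRing

namespace PreHilbertBimodule

open Filter

variable {A B C : Type u} [NonUnitalCStarAlgebra A] [NonUnitalCStarAlgebra B]
  [NonUnitalCStarAlgebra C] {V W : Type u} [AddCommGroup V] [Module ℂ V]
  [AddCommGroup W] [Module ℂ W] (p : PreHilbertBimodule A B V)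

lemma exists_lsmul_approx (x : V) : ∃ a : ℕ → A,
    Tendsto (fun k => ‖p.linner (x - p.lsmul (a k) x) (x - p.lsmul (a k) x)‖) atTop (nhds 0) := by
  obtain ⟨d, -, hd⟩ := p.exists_approx (Finset.univ : Finset Unit) (fun _ => x)
  exact ⟨_, hd () (Finset.mem_univ _)⟩

lemma exists_rsmul_approx (x : V) : ∃ b : ℕ → B,
    Tendsto (fun k => ‖p.rinner (x - p.rsmul (b k) x) (x - p.rsmul (b k) x)‖) atTop (nhds 0) := by
  obtain ⟨a, ha⟩ := p.dual.exists_lsmul_approx x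
  exact ⟨fun k => star (a k), ha⟩

lemma norm_linner_lsmul (a : A) (x : V) :
    ‖p.linner (p.lsmul a x) (p.lsmul a x)‖ ≤ ‖a‖ ^ 2 * ‖p.linner x x‖ := by
  rw [p.linner_lsmul, p.linner_lsmul_right]
  calc _ ≤ ‖a‖ * (‖p.linner x x‖ * ‖star a‖) :=
        (norm_mul_le _ _).trans (by gcongr; exact norm_mul_le _ _)
    _ = _ := by rw [norm_star]; ring

lemma norm_rinner_lsmul (h : p.WeakAssoc) (a : A) (x : V) :
    ‖p.rinner (p.lsmul a x) (p.lsmul a x)‖ ≤ ‖a‖ ^ 2 * ‖p.rinner x x‖ := by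
  rw [← p.norm_linner_eq_rinner h, ← p.norm_linner_eq_rinner h]
  exact p.norm_linner_lsmul a x

lemma norm_rinner_rsmul (b : B) (x : V) :
    ‖p.rinner (p.rsmul b x) (p.rsmul b x)‖ ≤ ‖b‖ ^ 2 * ‖p.rinner x x‖ := by
  rw [p.rinner_rsmul, p.rinner_rsmul_left]
  calc _ ≤ (‖star b‖ * ‖p.rinner x x‖) * ‖b‖ :=
        (norm_mul_le _ _).trans (by gcongr; exact norm_mul_le _ _)
    _ = _ := by rw [norm_star]; ring

lemma norm_rinner_lsmul_le (h : p.WeakAssoc) (x y : V) : ∃ K : ℝ, ∀ a,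
    ‖p.rinner x (p.lsmul a y)‖ ≤ K * ‖a‖ := by
  refine ⟨√(‖p.rinner x x‖ * ‖p.rinner y y‖), fun a => ?_⟩
  refine abs_le_of_sq_le_sq' ?_ (by positivity) |>.2
  rw [mul_pow, Real.sq_sqrt (by positivity)]
  calc _ ≤ ‖p.rinner x x‖ * ‖p.rinner (p.lsmul a y) (p.lsmul a y)‖ := p.rinner_cauchy _ _
    _ ≤ ‖p.rinner x x‖ * (‖a‖ ^ 2 * ‖p.rinner y y‖) := by
      gcongr
      exact p.norm_rinner_lsmul h a y
    _ = _ := by ring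

lemma tendsto_rinner {x : V} (y : V) {u : ℕ → V}
    (hu : Tendsto (fun k => ‖p.rinner (x - u k) (x - u k)‖) atTop (nhds 0)) :
    Tendsto (fun k => p.rinner y (u k)) atTop (nhds (p.rinner y x)) := by
  rw [tendsto_iff_norm_sub_tendsto_zero]
  have h1 : Tendsto (fun k => √(‖p.rinner y y‖ * ‖p.rinner (x - u k) (x - u k)‖)) atTop
      (nhds 0) := by
    have := (Real.continuous_sqrt.tendsto _).comp (hu.const_mul ‖p.rinner y y‖)
    rwa [mul_zero, Real.sqrt_zero] at this
  refine squeeze_zero (fun _ => norm_nonneg _) (fun k => ?_) h1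
  rw [← map_sub, ← norm_neg, ← map_neg, neg_sub]
  exact Real.le_sqrt_of_sq_le (p.rinner_cauchy _ _)

lemma dense_lsmul_of_norm {V : Type u} [NormedAddCommGroup V] [NormedSpace ℂ V]
    (p : PreHilbertBimodule A B V)
    (h : ∃ c > 0, ∃ C > 0, ∀ x, c * ‖x‖ ≤ √‖p.linner x x‖ ∧ √‖p.linner x x‖ ≤ C * ‖x‖) :
    Dense (Submodule.span ℂ {z | ∃ a x, z = p.lsmul a x} : Set V) := by
  intro x
  obtain ⟨a, ha⟩ := p.exists_lsmul_approx x
  obtain ⟨c, hc, C, -, hcC⟩ := h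
  refine mem_closure_of_tendsto (f := fun k => p.lsmul (a k) x) (b := atTop) ?_
    (.of_forall fun k => Submodule.subset_span ⟨a k, x, rfl⟩)
  rw [tendsto_iff_norm_sub_tendsto_zero]
  have h1 : Tendsto (fun k => c⁻¹ * √‖p.linner (x - p.lsmul (a k) x) (x - p.lsmul (a k) x)‖) atTop
      (nhds 0) := by
    have := ((Real.continuous_sqrt.tendsto _).comp ha).const_mul c⁻¹
    simpa using this
  refine squeeze_zero (fun _ => norm_nonneg _) (fun k => ?_) h1
  rw [norm_sub_rev, le_inv_mul_iff₀ hc]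
  exact (hcC _).1

lemma dense_rsmul_of_norm {V : Type u} [NormedAddCommGroup V] [NormedSpace ℂ V]
    (p : PreHilbertBimodule A B V)
    (h : ∃ c > 0, ∃ C > 0, ∀ x, c * ‖x‖ ≤ √‖p.rinner x x‖ ∧ √‖p.rinner x x‖ ≤ C * ‖x‖) :
    Dense (Submodule.span ℂ {z | ∃ b x, z = p.rsmul b x} : Set V) := by
  intro x
  obtain ⟨a, ha⟩ := p.exists_rsmul_approx x
  obtain ⟨c, hc, C, -, hcC⟩ := h
  refine mem_closure_of_tendsto (f := fun k => p.rsmul (a k) x) (b := atTop) ?_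
    (.of_forall fun k => Submodule.subset_span ⟨a k, x, rfl⟩)
  rw [tendsto_iff_norm_sub_tendsto_zero]
  have h1 : Tendsto (fun k => c⁻¹ * √‖p.rinner (x - p.rsmul (a k) x) (x - p.rsmul (a k) x)‖) atTop
      (nhds 0) := by
    have := ((Real.continuous_sqrt.tendsto _).comp ha).const_mul c⁻¹
    simpa using this
  refine squeeze_zero (fun _ => norm_nonneg _) (fun k => ?_) h1
  rw [norm_sub_rev, le_inv_mul_iff₀ hc]
  exact (hcC _).1

lemma tensor_sum_nonneg (q : PreHilbertBimodule B C W) (hp : p.WeakAssoc) (hq : q.WeakAssoc)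
    {ι : Type*} (s : Finset ι) (m : ι → V) (n : ι → W) :
    0 ≤ ∑ i ∈ s, ∑ j ∈ s, q.rinner (n i) (q.lsmul (p.rinner (m i) (m j)) (n j)) := by
  obtain ⟨d, hds, hd⟩ := p.exists_approx s m
  set h := ∑ i ∈ s, p.linner (m i) (m i) with hh
  have lim : Tendsto (fun k => ∑ i ∈ s, ∑ j ∈ s,
      q.rinner (n i) (q.lsmul (p.rinner (m i) (p.lsmul (d k * h * d k) (m j))) (n j))) atTop
      (nhds (∑ i ∈ s, ∑ j ∈ s, q.rinner (n i) (q.lsmul (p.rinner (m i) (m j)) (n j)))) := by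
    refine tendsto_finsetSum _ fun i _ => tendsto_finsetSum _ fun j hj => ?_
    have h1 := hd j hj
    simp only [p.norm_linner_eq_rinner hp] at h1
    have h2 := p.tendsto_rinner (m i) h1
    obtain ⟨K, hK⟩ := q.norm_rinner_lsmul_le hq (n i) (n j)
    let φ : B →L[ℂ] C := LinearMap.mkContinuous ((q.rinner (n i)).comp (q.lsmul.flip (n j))) K hK
    exact (φ.continuous.tendsto _).comp h2
  refine ge_of_tendsto' lim fun k => ?_
  have he : d k * h * d k = ∑ l ∈ s, p.linner (p.lsmul (d k) (m l)) (p.lsmul (d k) (m l)) := by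
    simp only [p.linner_lsmul, p.linner_lsmul_right, hds, hh, Finset.mul_sum, Finset.sum_mul,
      mul_assoc]
  have hS : ∑ i ∈ s, ∑ j ∈ s,
      q.rinner (n i) (q.lsmul (p.rinner (m i) (p.lsmul (d k * h * d k) (m j))) (n j))
      = ∑ l ∈ s, q.rinner (∑ i ∈ s, q.lsmul (p.rinner (p.lsmul (d k) (m l)) (m i)) (n i))
          (∑ i ∈ s, q.lsmul (p.rinner (p.lsmul (d k) (m l)) (m i)) (n i)) := by
    simp only [he, map_sum, LinearMap.sum_apply, hp.1, q.mul_lsmul, q.rinner_lsmul, p.star_rinner]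
    conv_rhs => rw [Finset.sum_comm]
    rw [Finset.sum_comm]
    exact Finset.sum_congr rfl fun j _ => Finset.sum_comm
  rw [hS]
  exact Finset.sum_nonneg fun l _ => q.rinner_self_nonneg _

end PreHilbertBimodule

end Order

namespace HilbertBimodule

variable {A B C D : Type u} [NonUnitalCStarAlgebra A] [NonUnitalCStarAlgebra B]
  [NonUnitalCStarAlgebra C] [NonUnitalCStarAlgebra D]

lemma weakAssoc (M : HilbertBimodule A B) : M.toPre.WeakAssoc := by
  refine ⟨fun w x y z => ?_, fun w x y z => ?_⟩
  · rw [M.assoc, M.toPre.rinner_rsmul]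
  · rw [← M.assoc, M.toPre.linner_lsmul]

/-- The dual bimodule `M*`, on the conjugate space of `M`. -/
noncomputable def dual (M : HilbertBimodule A B) : HilbertBimodule B A where
  carrier := ConjSpace M.carrier
  toPre := M.toPre.dual
  dense_lsmul := M.toPre.dual.dense_lsmul_of_norm M.rnorm_equiv
  dense_rsmul := M.toPre.dual.dense_rsmul_of_norm M.lnorm_equiv
  linner_definite := M.rinner_definite
  rinner_definite := M.linner_definite
  lnorm_equiv := M.rnorm_equiv
  rnorm_equiv := M.lnorm_equiv
  assoc x y z := by
    have h : ∀ x y z : M.carrier, M.toPre.rsmul (star (M.toPre.rinner x y)) z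
        = M.toPre.lsmul (star (M.toPre.linner y z)) x := by
      intro x y z
      rw [M.toPre.star_rinner, M.toPre.star_linner, M.assoc]
    exact h x y z

end HilbertBimodule

section Tensor

attribute [local instance] CStarAlgebra.spectralOrder CStarAlgebra.spectralOrderedRing

open TensorProduct

variable {A B C : Type u} [NonUnitalCStarAlgebra A] [NonUnitalCStarAlgebra B]
  [NonUnitalCStarAlgebra C] {V W : Type u} [AddCommGroup V] [Module ℂ V]
  [AddCommGroup W] [Module ℂ W]

namespace PreHilbertBimodule

variable (p : PreHilbertBimodule A B V) (q : PreHilbertBimodule B C W)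

/-- The `C`-valued form `⟨m ⊗ n, m' ⊗ n'⟩ = ⟨n, ⟨m, m'⟩_B n'⟩_C`. -/
noncomputable def tensorRinner : V ⊗[ℂ] W →ₗ⋆[ℂ] V ⊗[ℂ] W →ₗ[ℂ] C :=
  lift (LinearMap.mk₂'ₛₗ (starRingEnd ℂ) (starRingEnd ℂ)
    (fun m n => lift (LinearMap.mk₂ ℂ (fun m' n' => q.rinner n (q.lsmul (p.rinner m m') n'))
      (by simp) (by simp) (by simp) (by simp)))
    (fun _ _ _ => by ext; simp) (fun _ _ _ => by ext; simp)
    (fun _ _ _ => by ext; simp) (fun _ _ _ => by ext; simp))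

/-- The `A`-valued form `⟨m ⊗ n, m' ⊗ n'⟩ = ⟨m ⟨n, n'⟩_B, m'⟩_A`, with the left form on `W`. -/
noncomputable def tensorLinner : V ⊗[ℂ] W →ₗ[ℂ] V ⊗[ℂ] W →ₗ⋆[ℂ] A :=
  lift (LinearMap.mk₂ ℂ
    (fun m n => lift (LinearMap.mk₂'ₛₗ (starRingEnd ℂ) (starRingEnd ℂ)
      (fun m' n' => p.linner (p.rsmul (q.linner n n') m) m')
      (by simp) (by simp) (by simp) (by simp)))
    (fun _ _ _ => by ext; simp) (fun _ _ _ => by ext; simp)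
    (fun _ _ _ => by ext; simp) (fun _ _ _ => by ext; simp))

@[simp] lemma tensorRinner_tmul (m m' : V) (n n' : W) :
    p.tensorRinner q (m ⊗ₜ n) (m' ⊗ₜ n') = q.rinner n (q.lsmul (p.rinner m m') n') := rfl

@[simp] lemma tensorLinner_tmul (m m' : V) (n n' : W) :
    p.tensorLinner q (m ⊗ₜ n) (m' ⊗ₜ n') = p.linner (p.rsmul (q.linner n n') m) m' := rfl

lemma tensorRinner_nonneg (hp : p.WeakAssoc) (hq : q.WeakAssoc) (x : V ⊗[ℂ] W) :
    ∃ c, p.tensorRinner q x x = star c * c := by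
  obtain ⟨s, rfl⟩ := TensorProduct.exists_finset x
  refine exists_star_mul_self ?_
  have := p.tensor_sum_nonneg q hp hq s Prod.fst Prod.snd
  simp only [map_sum, LinearMap.sum_apply, tensorRinner_tmul]
  rwa [Finset.sum_comm]

lemma tensorLinner_nonneg (hp : p.WeakAssoc) (hq : q.WeakAssoc) (x : V ⊗[ℂ] W) :
    ∃ a, p.tensorLinner q x x = star a * a := by
  obtain ⟨s, rfl⟩ := TensorProduct.exists_finset x
  refine exists_star_mul_self ?_
  have this : (0 : A) ≤ ∑ i ∈ s, ∑ j ∈ s,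
      p.linner i.1 (p.rsmul (star (q.linner i.2 j.2)) j.1) :=
    q.dual.tensor_sum_nonneg p.dual hq.dual hp.dual s Prod.snd Prod.fst
  simp only [map_sum, LinearMap.sum_apply, tensorLinner_tmul, p.linner_rsmul]
  rwa [Finset.sum_comm]

/-- The algebraic tensor product `V ⊗ W` with its two forms. The differences
`m b ⊗ n - m ⊗ b n` are null vectors of the forms. -/
noncomputable def tensor (hp : p.WeakAssoc) (hq : q.WeakAssoc) :
    PreHilbertBimodule A C (V ⊗[ℂ] W) where
  lsmul := LinearMap.rTensorHom W ∘ₗ p.lsmul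
  rsmul := LinearMap.lTensorHom V ∘ₗ q.rsmul
  linner := p.tensorLinner q
  rinner := p.tensorRinner q
  mul_lsmul a a' x := by
    induction x with
    | zero => simp
    | add x y hx hy => simp only [map_add, hx, hy]
    | tmul m n => simp [p.mul_lsmul]
  mul_rsmul a a' x := by
    induction x with
    | zero => simp
    | add x y hx hy => simp only [map_add, hx, hy]
    | tmul m n => simp [q.mul_rsmul]
  lsmul_rsmul a b x := by
    induction x with
    | zero => simp
    | add x y hx hy => simp only [map_add, hx, hy]
    | tmul m n => simp
  linner_lsmul a x y := by
    induction x with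
    | zero => simp
    | add x y hx hy => simp only [map_add, LinearMap.add_apply, hx, hy, mul_add]
    | tmul m n =>
      induction y with
      | zero => simp
      | add x y hx hy => simp only [map_add, hx, hy, mul_add]
      | tmul m' n' => simp [p.lsmul_rsmul, p.linner_lsmul]
  rinner_rsmul a x y := by
    induction x with
    | zero => simp
    | add x y hx hy => simp only [map_add, LinearMap.add_apply, hx, hy, add_mul]
    | tmul m n =>
      induction y with
      | zero => simp
      | add x y hx hy => simp only [map_add, hx, hy, add_mul]
      | tmul m' n' => simp [← q.lsmul_rsmul, q.rinner_rsmul]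
  star_linner x y := by
    induction x with
    | zero => simp
    | add x y hx hy => simp only [map_add, LinearMap.add_apply, hx, hy, star_add]
    | tmul m n =>
      induction y with
      | zero => simp
      | add x y hx hy => simp only [map_add, LinearMap.add_apply, hx, hy, star_add]
      | tmul m' n' => simp [p.linner_rsmul, p.star_linner, q.star_linner]
  star_rinner x y := by
    induction x with
    | zero => simp
    | add x y hx hy => simp only [map_add, LinearMap.add_apply, hx, hy, star_add]
    | tmul m n =>
      induction y with
      | zero => simp
      | add x y hx hy => simp only [map_add, LinearMap.add_apply, hx, hy, star_add]
      | tmul m' n' => simp [q.rinner_lsmul, p.star_rinner, q.star_rinner]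
  linner_nonneg := p.tensorLinner_nonneg q hp hq
  rinner_nonneg := p.tensorRinner_nonneg q hp hq
  rinner_lsmul a x y := by
    induction x with
    | zero => simp
    | add x y hx hy => simp only [map_add, LinearMap.add_apply, hx, hy]
    | tmul m n =>
      induction y with
      | zero => simp
      | add x y hx hy => simp only [map_add, hx, hy]
      | tmul m' n' => simp [p.rinner_lsmul]
  linner_rsmul b x y := by
    induction x with
    | zero => simp
    | add x y hx hy => simp only [map_add, LinearMap.add_apply, hx, hy]
    | tmul m n =>
      induction y with
      | zero => simp
      | add x y hx hy => simp only [map_add, hx, hy]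
      | tmul m' n' => simp [q.linner_rsmul]

lemma tensor_weakAssoc (hp : p.WeakAssoc) (hq : q.WeakAssoc) : (p.tensor q hp hq).WeakAssoc := by
  refine ⟨fun w x y z => ?_, fun w x y z => ?_⟩
  · induction w with
    | zero => simp
    | add x y hx hy => simp only [map_add, LinearMap.add_apply, hx, hy, add_mul]
    | tmul m₀ n₀ =>
    induction x with
    | zero => simp
    | add x y hx hy => simp only [map_add, LinearMap.add_apply, hx, hy, add_mul]
    | tmul m n =>
    induction y with
    | zero => simp
    | add x y hx hy => simp only [map_add, LinearMap.add_apply, hx, hy, mul_add]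
    | tmul m' n' =>
    induction z with
    | zero => simp
    | add x y hx hy => simp only [map_add, hx, hy, mul_add]
    | tmul m'' n'' =>
    change q.rinner n₀ (q.lsmul (p.rinner m₀ (p.lsmul (p.linner (p.rsmul (q.linner n n') m) m')
      m'')) n'') = q.rinner n₀ (q.lsmul (p.rinner m₀ m) n) *
        q.rinner n' (q.lsmul (p.rinner m' m'') n'')
    rw [hp.1, p.rinner_rsmul, q.mul_lsmul, q.mul_lsmul, ← p.star_rinner m m₀, ← q.rinner_lsmul,
      hq.1, q.rinner_lsmul]
  · induction w with
    | zero => simp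
    | add x y hx hy => simp only [map_add, hx, hy, mul_add]
    | tmul m₀ n₀ =>
    induction x with
    | zero => simp
    | add x y hx hy => simp only [map_add, LinearMap.add_apply, hx, hy, add_mul]
    | tmul m n =>
    induction y with
    | zero => simp
    | add x y hx hy => simp only [map_add, LinearMap.add_apply, hx, hy, add_mul]
    | tmul m' n' =>
    induction z with
    | zero => simp
    | add x y hx hy => simp only [map_add, LinearMap.add_apply, hx, hy, mul_add]
    | tmul m'' n'' =>
    change p.linner (p.rsmul (q.linner (q.rsmul (q.rinner n' (q.lsmul (p.rinner m' m'') n'')) n)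
      n₀) m) m₀ = p.linner (p.rsmul (q.linner n n') m) m' *
        p.linner (p.rsmul (q.linner n'' n₀) m'') m₀
    rw [hq.2, q.linner_lsmul, p.mul_rsmul, p.mul_rsmul, p.linner_rsmul, hp.2, p.linner_rsmul _ m'']

end PreHilbertBimodule

end Tensor

section Completion

open UniformSpace

attribute [local instance] CStarAlgebra.spectralOrder CStarAlgebra.spectralOrderedRing

variable {A B : Type u} [NonUnitalCStarAlgebra A] [NonUnitalCStarAlgebra B]

namespace PreHilbertBimodule

section Seminorm

variable {V : Type u} [AddCommGroup V] [Module ℂ V] (p : PreHilbertBimodule A B V)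

/-- The seminorm `‖x‖ = ‖⟨x, x⟩_B‖ ^ (1/2)`. -/
noncomputable abbrev seminorm : Norm V := ⟨fun x => √‖p.rinner x x‖⟩

lemma seminorm_core : @SeminormedSpace.Core ℂ V _ _ p.seminorm _ :=
  letI := p.seminorm
  { norm_nonneg := fun x => Real.sqrt_nonneg _
    norm_smul := fun c x => by
      change √‖p.rinner (c • x) (c • x)‖ = ‖c‖ * √‖p.rinner x x‖
      simp only [map_smulₛₗ, LinearMap.smul_apply, norm_smul, RCLike.norm_conj, RingHom.id_apply]
      rw [← mul_assoc, Real.sqrt_mul (by positivity), Real.sqrt_mul_self (norm_nonneg _)]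
    norm_triangle := fun x y => by
      change √‖p.rinner (x + y) (x + y)‖ ≤ √‖p.rinner x x‖ + √‖p.rinner y y‖
      have h1 : ‖p.rinner x y‖ ≤ √‖p.rinner x x‖ * √‖p.rinner y y‖ := by
        rw [← Real.sqrt_mul (norm_nonneg _)]
        exact Real.le_sqrt_of_sq_le (p.rinner_cauchy x y)
      have h2 : ‖p.rinner y x‖ ≤ √‖p.rinner x x‖ * √‖p.rinner y y‖ := by
        rw [← p.star_rinner, norm_star]
        exact h1
      refine Real.sqrt_le_iff.mpr ⟨by positivity, ?_⟩
      have h3 : p.rinner (x + y) (x + y)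
          = p.rinner x x + p.rinner x y + (p.rinner y x + p.rinner y y) := by
        simp only [map_add, LinearMap.add_apply]
        abel
      rw [h3, add_sq, Real.sq_sqrt (norm_nonneg _), Real.sq_sqrt (norm_nonneg _)]
      have h4 := norm_add₃_le (a := p.rinner x x) (b := p.rinner x y)
        (c := p.rinner y x + p.rinner y y)
      have h5 := norm_add_le (p.rinner y x) (p.rinner y y)
      linarith }

/-- The seminormed group structure given by the `B`-valued form. -/
noncomputable abbrev seminormedAddCommGroup : SeminormedAddCommGroup V :=
  letI := p.seminorm
  SeminormedAddCommGroup.ofCore p.seminorm_core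

/-- The seminormed space structure given by the `B`-valued form. -/
noncomputable abbrev seminormedSpace :
    letI := p.seminormedAddCommGroup
    NormedSpace ℂ V :=
  letI := p.seminormedAddCommGroup
  { norm_smul_le := fun c x => (p.seminorm_core.norm_smul c x).le }

end Seminorm

section Extend

variable {E F X Y : Type u} [SeminormedAddCommGroup E] [NormedSpace ℂ E]
  [NormedAddCommGroup F] [NormedSpace ℂ F]
  [SeminormedAddCommGroup X] [NormedSpace ℂ X] [NormedAddCommGroup Y] [NormedSpace ℂ Y]
  [CompleteSpace Y] (e : E →ₗᵢ[ℂ] F)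

/-- Extension of a bounded (semi)linear map along a dense isometric map. -/
noncomputable def ext {σ : ℂ →+* ℂ} [RingHomIsometric σ] (f : E →SL[σ] Y) : F →SL[σ] Y :=
  f.extend e.toContinuousLinearMap

variable {e}

lemma ext_coe (he : DenseRange e) {σ : ℂ →+* ℂ} [RingHomIsometric σ] (f : E →SL[σ] Y) (x : E) :
    ext e f (e x) = f x :=
  f.extend_eq (e := e.toContinuousLinearMap) he e.isometry.isUniformInducing x

lemma norm_ext_le (he : DenseRange e) {σ : ℂ →+* ℂ} [RingHomIsometric σ] {f : E →SL[σ] Y} {C : ℝ}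
    (hf : ∀ x, ‖f x‖ ≤ C * ‖x‖) (x : F) : ‖ext e f x‖ ≤ C * ‖x‖ := by
  induction x using he.induction_on with
  | hp => exact isClosed_le (by fun_prop) (by fun_prop)
  | ih x =>
    rw [ext_coe he, e.norm_map]
    exact hf x

/-- Extension of a bounded (semi)bilinear map in both variables. -/
noncomputable def ext₂ (he : DenseRange e) {σ τ : ℂ →+* ℂ} [RingHomIsometric σ]
    [RingHomIsometric τ] (f : E →SL[σ] E →SL[τ] Y) : F →SL[σ] F →SL[τ] Y :=
  ext (Y := F →SL[τ] Y) e
    (LinearMap.mkContinuous₂ (LinearMap.mk₂'ₛₗ σ τ (fun x y => ext e (f x) y)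
      (fun x x' y => by
        induction y using he.induction_on with
        | hp => exact isClosed_eq (by fun_prop) (by fun_prop)
        | ih y => simp [ext_coe he])
      (fun c x y => by
        induction y using he.induction_on with
        | hp => exact isClosed_eq (by fun_prop) (by fun_prop)
        | ih y => simp [ext_coe he])
      (by simp) (by simp)) ‖f‖ (fun x y => norm_ext_le he (f.le_opNorm₂ x) y))

lemma ext₂_coe (he : DenseRange e) {σ τ : ℂ →+* ℂ} [RingHomIsometric σ] [RingHomIsometric τ]
    (f : E →SL[σ] E →SL[τ] Y) (x y : E) : ext₂ he f (e x) (e y) = f x y := by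
  rw [ext₂, ext_coe he]
  exact ext_coe he _ y

lemma continuous_apply₂ {X Y Z : Type*} [NormedAddCommGroup X] [NormedSpace ℂ X]
    [NormedAddCommGroup Y] [NormedSpace ℂ Y] [NormedAddCommGroup Z] [NormedSpace ℂ Z]
    {σ τ : ℂ →+* ℂ} [RingHomIsometric σ] [RingHomIsometric τ] (T : X →SL[σ] Y →SL[τ] Z)
    {α : Type*} [TopologicalSpace α] {f : α → X} {g : α → Y} (hf : Continuous f)
    (hg : Continuous g) : Continuous fun t => T (f t) (g t) := by
  refine continuous_iff_continuousAt.mpr fun t => ?_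
  rw [ContinuousAt, tendsto_iff_norm_sub_tendsto_zero]
  have h1 : Continuous fun s => ‖T‖ * ‖f s - f t‖ * ‖g s‖ + ‖T (f t)‖ * ‖g s - g t‖ := by
    fun_prop
  refine squeeze_zero (fun _ => norm_nonneg _) (fun s => ?_) (h1.tendsto' t 0 (by simp))
  have h2 : T (f s) (g s) - T (f t) (g t) = T (f s - f t) (g s) + T (f t) (g s - g t) := by
    simp
  rw [h2]
  refine (norm_add_le _ _).trans ?_
  gcongr
  · exact T.le_opNorm₂ _ _
  · exact (T (f t)).le_opNorm _

end Extend

variable {E F : Type u} [SeminormedAddCommGroup E] [NormedSpace ℂ E]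
  [NormedAddCommGroup F] [NormedSpace ℂ F]
  (p : PreHilbertBimodule A B E)

lemma norm_rinner_le (hn : ∀ x, ‖x‖ = √‖p.rinner x x‖) (x y : E) : ‖p.rinner x y‖ ≤ 1 * ‖x‖ * ‖y‖ := by
  rw [hn, hn, one_mul, ← Real.sqrt_mul (norm_nonneg _)]
  exact Real.le_sqrt_of_sq_le (p.rinner_cauchy x y)

lemma norm_linner_le (hp : p.WeakAssoc) (hn : ∀ x, ‖x‖ = √‖p.rinner x x‖) (x y : E) : ‖p.linner x y‖ ≤ 1 * ‖x‖ * ‖y‖ := by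
  rw [hn, hn, one_mul, ← Real.sqrt_mul (norm_nonneg _), ← p.norm_linner_eq_rinner hp,
    ← p.norm_linner_eq_rinner hp]
  exact Real.le_sqrt_of_sq_le (p.linner_cauchy x y)

lemma norm_lsmul_le (hp : p.WeakAssoc) (hn : ∀ x, ‖x‖ = √‖p.rinner x x‖) (e : E →ₗᵢ[ℂ] F)
    (a : A) (x : E) : ‖e (p.lsmul a x)‖ ≤ 1 * ‖a‖ * ‖x‖ := by
  rw [e.norm_map, hn, hn, one_mul]
  refine Real.sqrt_le_iff.mpr ⟨by positivity, ?_⟩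
  rw [mul_pow, Real.sq_sqrt (norm_nonneg _)]
  exact p.norm_rinner_lsmul hp a x

lemma norm_rsmul_le (hn : ∀ x, ‖x‖ = √‖p.rinner x x‖) (e : E →ₗᵢ[ℂ] F)
    (b : B) (x : E) : ‖e (p.rsmul b x)‖ ≤ 1 * ‖b‖ * ‖x‖ := by
  rw [e.norm_map, hn, hn, one_mul]
  refine Real.sqrt_le_iff.mpr ⟨by positivity, ?_⟩
  rw [mul_pow, Real.sq_sqrt (norm_nonneg _)]
  exact p.norm_rinner_rsmul b x

noncomputable def complRinner (hn : ∀ x, ‖x‖ = √‖p.rinner x x‖) {e : E →ₗᵢ[ℂ] F} (he : DenseRange e) :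
    F →L⋆[ℂ] F →L[ℂ] B :=
  ext₂ he (p.rinner.mkContinuous₂ 1 (p.norm_rinner_le hn))

noncomputable def complLinner (hp : p.WeakAssoc) (hn : ∀ x, ‖x‖ = √‖p.rinner x x‖) {e : E →ₗᵢ[ℂ] F} (he : DenseRange e) :
    F →L[ℂ] F →L⋆[ℂ] A :=
  ext₂ he (p.linner.mkContinuous₂ 1 (p.norm_linner_le hp hn))

noncomputable def complLsmul [CompleteSpace F] (hp : p.WeakAssoc) (hn : ∀ x, ‖x‖ = √‖p.rinner x x‖) (e : E →ₗᵢ[ℂ] F) :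
    A →L[ℂ] F →L[ℂ] F :=
  (ext e ((p.lsmul.compr₂ e.toLinearMap).mkContinuous₂ 1 (p.norm_lsmul_le hp hn e)).flip).flip

noncomputable def complRsmul [CompleteSpace F] (hn : ∀ x, ‖x‖ = √‖p.rinner x x‖) (e : E →ₗᵢ[ℂ] F) :
    B →L[ℂ] F →L[ℂ] F :=
  (ext e ((p.rsmul.compr₂ e.toLinearMap).mkContinuous₂ 1 (p.norm_rsmul_le hn e)).flip).flip

@[fun_prop]
lemma continuous_complRinner (hn : ∀ x, ‖x‖ = √‖p.rinner x x‖)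
    {e : E →ₗᵢ[ℂ] F} (he : DenseRange e) {α : Type*} [TopologicalSpace α] {f : α → F}
    {g : α → F} (hf : Continuous f) (hg : Continuous g) :
    Continuous fun t => p.complRinner hn he (f t) (g t) :=
  continuous_apply₂ (p.complRinner hn he) hf hg

@[fun_prop]
lemma continuous_complLinner (hp : p.WeakAssoc) (hn : ∀ x, ‖x‖ = √‖p.rinner x x‖)
    {e : E →ₗᵢ[ℂ] F} (he : DenseRange e) {α : Type*} [TopologicalSpace α] {f : α → F}
    {g : α → F} (hf : Continuous f) (hg : Continuous g) :
    Continuous fun t => p.complLinner hp hn he (f t) (g t) :=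
  continuous_apply₂ (p.complLinner hp hn he) hf hg

@[fun_prop]
lemma continuous_complLsmul [CompleteSpace F] (hp : p.WeakAssoc) (hn : ∀ x, ‖x‖ = √‖p.rinner x x‖)
    {e : E →ₗᵢ[ℂ] F} {α : Type*} [TopologicalSpace α] {f : α → A}
    {g : α → F} (hf : Continuous f) (hg : Continuous g) :
    Continuous fun t => p.complLsmul hp hn e (f t) (g t) :=
  continuous_apply₂ (p.complLsmul hp hn e) hf hg

lemma complRinner_coe (hn : ∀ x, ‖x‖ = √‖p.rinner x x‖) {e : E →ₗᵢ[ℂ] F}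
    (he : DenseRange e) (x y : E) : p.complRinner hn he (e x) (e y) = p.rinner x y :=
  ext₂_coe he _ x y

lemma complLinner_coe (hp : p.WeakAssoc) (hn : ∀ x, ‖x‖ = √‖p.rinner x x‖) {e : E →ₗᵢ[ℂ] F}
    (he : DenseRange e) (x y : E) : p.complLinner hp hn he (e x) (e y) = p.linner x y :=
  ext₂_coe he _ x y

lemma complLsmul_coe [CompleteSpace F] (hp : p.WeakAssoc) (hn : ∀ x, ‖x‖ = √‖p.rinner x x‖) {e : E →ₗᵢ[ℂ] F}
    (he : DenseRange e) (a : A) (x : E) : p.complLsmul hp hn e a (e x) = e (p.lsmul a x) := by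
  simp only [complLsmul, ContinuousLinearMap.flip_apply, ext_coe he]
  rfl

lemma complRsmul_coe [CompleteSpace F] (hn : ∀ x, ‖x‖ = √‖p.rinner x x‖) {e : E →ₗᵢ[ℂ] F}
    (he : DenseRange e) (b : B) (x : E) : p.complRsmul hn e b (e x) = e (p.rsmul b x) := by
  simp only [complRsmul, ContinuousLinearMap.flip_apply, ext_coe he]
  rfl

/-- The completion of a bimodule with respect to the seminorm of its `B`-valued form. -/
noncomputable def preCompletion [CompleteSpace F] (hp : p.WeakAssoc) (hn : ∀ x, ‖x‖ = √‖p.rinner x x‖)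
    {e : E →ₗᵢ[ℂ] F} (he : DenseRange e) : PreHilbertBimodule A B F where
  lsmul := LinearMap.mk₂ ℂ (fun a x => p.complLsmul hp hn e a x)
    (by simp) (by simp) (by simp) (by simp)
  rsmul := LinearMap.mk₂ ℂ (fun b x => p.complRsmul hn e b x)
    (by simp) (by simp) (by simp) (by simp)
  linner := LinearMap.mk₂'ₛₗ (RingHom.id ℂ) (starRingEnd ℂ) (fun x y => p.complLinner hp hn he x y)
    (by simp) (by simp) (by simp) (by simp)
  rinner := LinearMap.mk₂'ₛₗ (starRingEnd ℂ) (RingHom.id ℂ) (fun x y => p.complRinner hn he x y)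
    (by simp) (by simp) (by simp) (by simp)
  mul_lsmul a a' x := by
    simp only [LinearMap.mk₂_apply]
    induction x using he.induction_on with
    | hp => exact isClosed_eq (by fun_prop) (by fun_prop)
    | ih x => simp only [complLsmul_coe (he := he), p.mul_lsmul]
  mul_rsmul b b' x := by
    simp only [LinearMap.mk₂_apply]
    induction x using he.induction_on with
    | hp => exact isClosed_eq (by fun_prop) (by fun_prop)
    | ih x => simp only [complRsmul_coe (he := he), p.mul_rsmul]
  lsmul_rsmul a b x := by
    simp only [LinearMap.mk₂_apply]
    induction x using he.induction_on with
    | hp => exact isClosed_eq (by fun_prop) (by fun_prop)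
    | ih x => simp only [complLsmul_coe (he := he), complRsmul_coe (he := he), p.lsmul_rsmul]
  linner_lsmul a x y := by
    simp only [LinearMap.mk₂_apply, LinearMap.mk₂'ₛₗ_apply]
    induction x, y using he.induction_on₂ with
    | hp => exact isClosed_eq (by fun_prop) (by fun_prop)
    | h x y => simp only [complLsmul_coe (he := he), complLinner_coe (he := he), p.linner_lsmul]
  rinner_rsmul b x y := by
    simp only [LinearMap.mk₂_apply, LinearMap.mk₂'ₛₗ_apply]
    induction x, y using he.induction_on₂ with
    | hp => exact isClosed_eq (by fun_prop) (by fun_prop)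
    | h x y => simp only [complRsmul_coe (he := he), complRinner_coe (he := he), p.rinner_rsmul]
  star_linner x y := by
    simp only [LinearMap.mk₂'ₛₗ_apply]
    induction x, y using he.induction_on₂ with
    | hp => exact isClosed_eq (by fun_prop) (by fun_prop)
    | h x y => simp only [complLinner_coe (he := he), p.star_linner]
  star_rinner x y := by
    simp only [LinearMap.mk₂'ₛₗ_apply]
    induction x, y using he.induction_on₂ with
    | hp => exact isClosed_eq (by fun_prop) (by fun_prop)
    | h x y => simp only [complRinner_coe (he := he), p.star_rinner]
  linner_nonneg x := by
    simp only [LinearMap.mk₂'ₛₗ_apply]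
    refine exists_star_mul_self ?_
    induction x using he.induction_on with
    | hp => exact isClosed_le continuous_const (by fun_prop)
    | ih x =>
      rw [complLinner_coe (he := he)]
      exact p.linner_self_nonneg x
  rinner_nonneg x := by
    simp only [LinearMap.mk₂'ₛₗ_apply]
    refine exists_star_mul_self ?_
    induction x using he.induction_on with
    | hp => exact isClosed_le continuous_const (by fun_prop)
    | ih x =>
      rw [complRinner_coe (he := he)]
      exact p.rinner_self_nonneg x
  rinner_lsmul a x y := by
    simp only [LinearMap.mk₂_apply, LinearMap.mk₂'ₛₗ_apply]
    induction x, y using he.induction_on₂ with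
    | hp => exact isClosed_eq (by fun_prop) (by fun_prop)
    | h x y => simp only [complLsmul_coe (he := he), complRinner_coe (he := he), p.rinner_lsmul]
  linner_rsmul b x y := by
    simp only [LinearMap.mk₂_apply, LinearMap.mk₂'ₛₗ_apply]
    induction x, y using he.induction_on₂ with
    | hp => exact isClosed_eq (by fun_prop) (by fun_prop)
    | h x y => simp only [complRsmul_coe (he := he), complLinner_coe (he := he), p.linner_rsmul]

lemma norm_preCompletion_rinner [CompleteSpace F] (hp : p.WeakAssoc) (hn : ∀ x, ‖x‖ = √‖p.rinner x x‖)
    {e : E →ₗᵢ[ℂ] F} (he : DenseRange e) (x : F) :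
    √‖(p.preCompletion hp hn he).rinner x x‖ = ‖x‖ := by
  simp only [preCompletion, LinearMap.mk₂'ₛₗ_apply]
  induction x using he.induction_on with
  | hp => exact isClosed_eq (by fun_prop) (by fun_prop)
  | ih x => rw [complRinner_coe, e.norm_map, hn]

lemma norm_preCompletion_linner [CompleteSpace F] (hp : p.WeakAssoc) (hn : ∀ x, ‖x‖ = √‖p.rinner x x‖)
    {e : E →ₗᵢ[ℂ] F} (he : DenseRange e) (x : F) :
    √‖(p.preCompletion hp hn he).linner x x‖ = ‖x‖ := by
  simp only [preCompletion, LinearMap.mk₂'ₛₗ_apply]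
  induction x using he.induction_on with
  | hp => exact isClosed_eq (by fun_prop) (by fun_prop)
  | ih x => rw [complLinner_coe, e.norm_map, hn, p.norm_linner_eq_rinner hp]

lemma preCompletion_weakAssoc [CompleteSpace F] (hp : p.WeakAssoc) (hn : ∀ x, ‖x‖ = √‖p.rinner x x‖)
    {e : E →ₗᵢ[ℂ] F} (he : DenseRange e) (w x y z : F) :
    (p.preCompletion hp hn he).rinner w
        ((p.preCompletion hp hn he).lsmul ((p.preCompletion hp hn he).linner x y) z)
      = (p.preCompletion hp hn he).rinner w x * (p.preCompletion hp hn he).rinner y z := by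
  simp only [preCompletion, LinearMap.mk₂_apply, LinearMap.mk₂'ₛₗ_apply]
  induction w using he.induction_on with
  | hp => exact isClosed_eq (by fun_prop) (by fun_prop)
  | ih w =>
  induction x, y, z using he.induction_on₃ with
  | hp => exact isClosed_eq (by fun_prop) (by fun_prop)
  | h x y z => simp only [complLinner_coe, complRinner_coe, complLsmul_coe (he := he), hp.1]

/-- The completion of a bimodule with respect to the seminorm of its `B`-valued form. -/
noncomputable def completion [CompleteSpace F] (hp : p.WeakAssoc) (hn : ∀ x, ‖x‖ = √‖p.rinner x x‖)
    {e : E →ₗᵢ[ℂ] F} (he : DenseRange e) : HilbertBimodule A B :=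
  have hl : ∃ c > 0, ∃ C > 0, ∀ x, c * ‖x‖ ≤ √‖(p.preCompletion hp hn he).linner x x‖ ∧
      √‖(p.preCompletion hp hn he).linner x x‖ ≤ C * ‖x‖ :=
    ⟨1, one_pos, 1, one_pos, fun x => by simp [norm_preCompletion_linner]⟩
  have hr : ∃ c > 0, ∃ C > 0, ∀ x, c * ‖x‖ ≤ √‖(p.preCompletion hp hn he).rinner x x‖ ∧
      √‖(p.preCompletion hp hn he).rinner x x‖ ≤ C * ‖x‖ :=
    ⟨1, one_pos, 1, one_pos, fun x => by simp [norm_preCompletion_rinner]⟩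
  have hd : ∀ x, (p.preCompletion hp hn he).rinner x x = 0 → x = 0 := fun x hx => by
    rw [← norm_eq_zero, ← p.norm_preCompletion_rinner hp hn he x, hx, norm_zero, Real.sqrt_zero]
  { carrier := F
    toPre := p.preCompletion hp hn he
    dense_lsmul := dense_lsmul_of_norm _ hl
    dense_rsmul := dense_rsmul_of_norm _ hr
    linner_definite := fun x hx => by
      rw [← norm_eq_zero, ← p.norm_preCompletion_linner hp hn he x, hx, norm_zero, Real.sqrt_zero]
    rinner_definite := hd
    lnorm_equiv := hl
    rnorm_equiv := hr
    assoc := fun x y z => by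
      rw [← sub_eq_zero]
      refine hd _ ?_
      rw [map_sub, preCompletion_weakAssoc, rinner_rsmul, sub_self] }

end PreHilbertBimodule

end Completion

namespace HilbertBimodule

open UniformSpace TensorProduct

variable {A B C D : Type u} [NonUnitalCStarAlgebra A] [NonUnitalCStarAlgebra B]
  [NonUnitalCStarAlgebra C] [NonUnitalCStarAlgebra D]

/-- The interior tensor product `M ⊗_B N`: the algebraic tensor product over `ℂ` is completed in
the seminorm of its inner product, which also divides out the null vectors, hence the differences
`m b ⊗ n - m ⊗ b n`. -/
noncomputable def tensor (M : HilbertBimodule A B) (N : HilbertBimodule B C) :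
    HilbertBimodule A C :=
  letI := (M.toPre.tensor N.toPre M.weakAssoc N.weakAssoc).seminormedAddCommGroup
  letI := (M.toPre.tensor N.toPre M.weakAssoc N.weakAssoc).seminormedSpace
  (M.toPre.tensor N.toPre M.weakAssoc N.weakAssoc).completion
    (M.toPre.tensor_weakAssoc N.toPre M.weakAssoc N.weakAssoc) (fun _ => rfl)
    (e := Completion.toComplₗᵢ) Completion.denseRange_coe

/-- The canonical map from the algebraic tensor product. -/
noncomputable def ofTensor (M : HilbertBimodule A B) (N : HilbertBimodule B C) :
    M.carrier ⊗[ℂ] N.carrier →ₗ[ℂ] (M.tensor N).carrier :=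
  letI := (M.toPre.tensor N.toPre M.weakAssoc N.weakAssoc).seminormedAddCommGroup
  letI := (M.toPre.tensor N.toPre M.weakAssoc N.weakAssoc).seminormedSpace
  (Completion.toComplₗᵢ (𝕜 := ℂ) (E := M.carrier ⊗[ℂ] N.carrier)).toLinearMap

variable (M : HilbertBimodule A B) (N : HilbertBimodule B C)

lemma denseRange_ofTensor : DenseRange (M.ofTensor N) :=
  letI := (M.toPre.tensor N.toPre M.weakAssoc N.weakAssoc).seminormedAddCommGroup
  letI := (M.toPre.tensor N.toPre M.weakAssoc N.weakAssoc).seminormedSpace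
  Completion.denseRange_coe

lemma rinner_ofTensor (x y : M.carrier ⊗[ℂ] N.carrier) :
    (M.tensor N).toPre.rinner (M.ofTensor N x) (M.ofTensor N y)
      = M.toPre.tensorRinner N.toPre x y :=
  letI := (M.toPre.tensor N.toPre M.weakAssoc N.weakAssoc).seminormedAddCommGroup
  letI := (M.toPre.tensor N.toPre M.weakAssoc N.weakAssoc).seminormedSpace
  PreHilbertBimodule.complRinner_coe (M.toPre.tensor N.toPre M.weakAssoc N.weakAssoc)
    (fun _ => rfl) (e := Completion.toComplₗᵢ) Completion.denseRange_coe x y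

lemma linner_ofTensor (x y : M.carrier ⊗[ℂ] N.carrier) :
    (M.tensor N).toPre.linner (M.ofTensor N x) (M.ofTensor N y)
      = M.toPre.tensorLinner N.toPre x y :=
  letI := (M.toPre.tensor N.toPre M.weakAssoc N.weakAssoc).seminormedAddCommGroup
  letI := (M.toPre.tensor N.toPre M.weakAssoc N.weakAssoc).seminormedSpace
  PreHilbertBimodule.complLinner_coe (M.toPre.tensor N.toPre M.weakAssoc N.weakAssoc)
    (M.toPre.tensor_weakAssoc N.toPre M.weakAssoc N.weakAssoc)
    (fun _ => rfl) (e := Completion.toComplₗᵢ) Completion.denseRange_coe x y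

lemma lsmul_ofTensor (a : A) (x : M.carrier ⊗[ℂ] N.carrier) :
    (M.tensor N).toPre.lsmul a (M.ofTensor N x)
      = M.ofTensor N ((M.toPre.tensor N.toPre M.weakAssoc N.weakAssoc).lsmul a x) :=
  letI := (M.toPre.tensor N.toPre M.weakAssoc N.weakAssoc).seminormedAddCommGroup
  letI := (M.toPre.tensor N.toPre M.weakAssoc N.weakAssoc).seminormedSpace
  PreHilbertBimodule.complLsmul_coe (M.toPre.tensor N.toPre M.weakAssoc N.weakAssoc)
    (M.toPre.tensor_weakAssoc N.toPre M.weakAssoc N.weakAssoc)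
    (fun _ => rfl) (e := Completion.toComplₗᵢ) Completion.denseRange_coe a x

lemma rsmul_ofTensor (c : C) (x : M.carrier ⊗[ℂ] N.carrier) :
    (M.tensor N).toPre.rsmul c (M.ofTensor N x)
      = M.ofTensor N ((M.toPre.tensor N.toPre M.weakAssoc N.weakAssoc).rsmul c x) :=
  letI := (M.toPre.tensor N.toPre M.weakAssoc N.weakAssoc).seminormedAddCommGroup
  letI := (M.toPre.tensor N.toPre M.weakAssoc N.weakAssoc).seminormedSpace
  PreHilbertBimodule.complRsmul_coe (M.toPre.tensor N.toPre M.weakAssoc N.weakAssoc)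
    (fun _ => rfl) (e := Completion.toComplₗᵢ) Completion.denseRange_coe c x

attribute [irreducible] tensor ofTensor

/-- The elementary tensor `m ⊗ n` in the interior tensor product. -/
noncomputable def tmul : M.carrier →ₗ[ℂ] N.carrier →ₗ[ℂ] (M.tensor N).carrier :=
  (TensorProduct.mk ℂ M.carrier N.carrier).compr₂ (M.ofTensor N)

lemma rinner_tmul (m m' : M.carrier) (n n' : N.carrier) :
    (M.tensor N).toPre.rinner (M.tmul N m n) (M.tmul N m' n')
      = N.toPre.rinner n (N.toPre.lsmul (M.toPre.rinner m m') n') :=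
  M.rinner_ofTensor N _ _

lemma linner_tmul (m m' : M.carrier) (n n' : N.carrier) :
    (M.tensor N).toPre.linner (M.tmul N m n) (M.tmul N m' n')
      = M.toPre.linner (M.toPre.rsmul (N.toPre.linner n n') m) m' :=
  M.linner_ofTensor N _ _

lemma lsmul_tmul (a : A) (m : M.carrier) (n : N.carrier) :
    (M.tensor N).toPre.lsmul a (M.tmul N m n) = M.tmul N (M.toPre.lsmul a m) n :=
  M.lsmul_ofTensor N _ _

lemma rsmul_tmul (c : C) (m : M.carrier) (n : N.carrier) :
    (M.tensor N).toPre.rsmul c (M.tmul N m n) = M.tmul N m (N.toPre.rsmul c n) :=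
  M.rsmul_ofTensor N _ _

lemma dense_tmul : Dense (Submodule.span ℂ
    (Set.range fun x : M.carrier × N.carrier => M.tmul N x.1 x.2) : Set (M.tensor N).carrier) := by
  refine (M.denseRange_ofTensor N).mono ?_
  rintro _ ⟨x, rfl⟩
  induction x with
  | zero => simp
  | add x y hx hy =>
    rw [map_add]
    exact Submodule.add_mem _ hx hy
  | tmul m n => exact Submodule.subset_span ⟨(m, n), rfl⟩

variable {M N}

lemma exists_rinner_bound (M : HilbertBimodule A B) :
    ∃ K : ℝ, ∀ x y, ‖M.toPre.rinner x y‖ ≤ K * ‖x‖ * ‖y‖ := by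
  obtain ⟨c, hc, K, hK, h⟩ := M.rnorm_equiv
  refine ⟨K * K, fun x y => ?_⟩
  have h1 : ‖M.toPre.rinner x y‖ ≤ √‖M.toPre.rinner x x‖ * √‖M.toPre.rinner y y‖ := by
    rw [← Real.sqrt_mul (norm_nonneg _)]
    exact Real.le_sqrt_of_sq_le (M.toPre.rinner_cauchy x y)
  calc _ ≤ _ := h1
    _ ≤ (K * ‖x‖) * (K * ‖y‖) := by
      gcongr
      · exact (h x).2
      · exact (h y).2
    _ = _ := by ring

lemma exists_linner_bound (M : HilbertBimodule A B) :
    ∃ K : ℝ, ∀ x y, ‖M.toPre.linner x y‖ ≤ K * ‖x‖ * ‖y‖ := M.dual.exists_rinner_bound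

lemma continuous_rinner (M : HilbertBimodule A B) :
    Continuous fun x : M.carrier × M.carrier => M.toPre.rinner x.1 x.2 := by
  obtain ⟨K, hK⟩ := M.exists_rinner_bound
  exact PreHilbertBimodule.continuous_apply₂ (M.toPre.rinner.mkContinuous₂ K hK)
    continuous_fst continuous_snd

lemma continuous_linner (M : HilbertBimodule A B) :
    Continuous fun x : M.carrier × M.carrier => M.toPre.linner x.1 x.2 := by
  obtain ⟨K, hK⟩ := M.exists_linner_bound
  exact PreHilbertBimodule.continuous_apply₂ (M.toPre.linner.mkContinuous₂ K hK)
    continuous_fst continuous_snd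

lemma exists_tmul_bound (M : HilbertBimodule A B) (N : HilbertBimodule B C) :
    ∃ K : ℝ, ∀ x y, ‖M.tmul N x y‖ ≤ K * ‖x‖ * ‖y‖ := by
  obtain ⟨c, hc, C', hC', h⟩ := (M.tensor N).rnorm_equiv
  obtain ⟨k, hk, K, hK, hM⟩ := M.rnorm_equiv
  obtain ⟨l, hl, L, hL, hN⟩ := N.rnorm_equiv
  refine ⟨c⁻¹ * (K * L), fun x y => ?_⟩
  have h1 := (h (M.tmul N x y)).1
  rw [rinner_tmul] at h1
  have h2 : √‖N.toPre.rinner y (N.toPre.lsmul (M.toPre.rinner x x) y)‖ ≤ K * L * ‖x‖ * ‖y‖ := by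
    refine Real.sqrt_le_iff.mpr ⟨by positivity, ?_⟩
    have h3 := N.toPre.rinner_cauchy y (N.toPre.lsmul (M.toPre.rinner x x) y)
    have h4 := N.toPre.norm_rinner_lsmul N.weakAssoc (M.toPre.rinner x x) y
    have h5 : ‖N.toPre.rinner y (N.toPre.lsmul (M.toPre.rinner x x) y)‖
        ≤ ‖M.toPre.rinner x x‖ * ‖N.toPre.rinner y y‖ := by
      refine abs_le_of_sq_le_sq' ?_ (by positivity) |>.2
      refine h3.trans ((mul_le_mul_of_nonneg_left h4 (norm_nonneg _)).trans (le_of_eq ?_))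
      ring
    have h6 : ‖M.toPre.rinner x x‖ ≤ (K * ‖x‖) ^ 2 := Real.sqrt_le_left (by positivity) |>.mp
      (hM x).2
    have h7 : ‖N.toPre.rinner y y‖ ≤ (L * ‖y‖) ^ 2 := Real.sqrt_le_left (by positivity) |>.mp
      (hN y).2
    calc _ ≤ _ := h5
      _ ≤ (K * ‖x‖) ^ 2 * (L * ‖y‖) ^ 2 := by gcongr
      _ = _ := by ring
  rw [mul_assoc, mul_assoc, le_inv_mul_iff₀ hc]
  calc _ ≤ _ := h1
    _ ≤ _ := h2
    _ = _ := by ring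

lemma continuous_tmul (M : HilbertBimodule A B) (N : HilbertBimodule B C) :
    Continuous fun x : M.carrier × N.carrier => M.tmul N x.1 x.2 := by
  obtain ⟨K, hK⟩ := M.exists_tmul_bound N
  exact PreHilbertBimodule.continuous_apply₂ ((M.tmul N).mkContinuous₂ K hK)
    continuous_fst continuous_snd

/-- An isomorphism of associative Hilbert C*-bimodules: a bicontinuous linear bijection that
preserves both actions and both inner products. -/
structure Iso (M N : HilbertBimodule A B) where
  toEquiv : M.carrier ≃L[ℂ] N.carrier
  map_lsmul : ∀ a x, toEquiv (M.toPre.lsmul a x) = N.toPre.lsmul a (toEquiv x)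
  map_rsmul : ∀ b x, toEquiv (M.toPre.rsmul b x) = N.toPre.rsmul b (toEquiv x)
  map_linner : ∀ x y, N.toPre.linner (toEquiv x) (toEquiv y) = M.toPre.linner x y
  map_rinner : ∀ x y, N.toPre.rinner (toEquiv x) (toEquiv y) = M.toPre.rinner x y

/-- The isomorphism of a bimodule with itself. -/
def Iso.refl (M : HilbertBimodule A B) : Iso M M :=
  ⟨.refl ℂ _, by simp, by simp, by simp, by simp⟩

/-- The inverse isomorphism. -/
def Iso.symm {M N : HilbertBimodule A B} (U : Iso M N) : Iso N M where
  toEquiv := U.toEquiv.symm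
  map_lsmul a x := by rw [ContinuousLinearEquiv.symm_apply_eq, U.map_lsmul]; simp
  map_rsmul a x := by rw [ContinuousLinearEquiv.symm_apply_eq, U.map_rsmul]; simp
  map_linner x y := by rw [← U.map_linner]; simp
  map_rinner x y := by rw [← U.map_rinner]; simp

/-- The composite isomorphism. -/
def Iso.trans {M N P : HilbertBimodule A B} (U : Iso M N) (V : Iso N P) : Iso M P where
  toEquiv := U.toEquiv.trans V.toEquiv
  map_lsmul a x := by simp [U.map_lsmul, V.map_lsmul]
  map_rsmul a x := by simp [U.map_rsmul, V.map_rsmul]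
  map_linner x y := by simp [U.map_linner, V.map_linner]
  map_rinner x y := by simp [U.map_rinner, V.map_rinner]

/-- Two bimodules generated by families with the same inner products are isomorphic. -/
lemma nonempty_iso {M N : HilbertBimodule A B} {ι : Type*} (f : ι → M.carrier) (g : ι → N.carrier)
    (hf : Dense (Submodule.span ℂ (Set.range f) : Set M.carrier))
    (hg : Dense (Submodule.span ℂ (Set.range g) : Set N.carrier))
    (hl : ∀ i j, M.toPre.linner (f i) (f j) = N.toPre.linner (g i) (g j))
    (hr : ∀ i j, M.toPre.rinner (f i) (f j) = N.toPre.rinner (g i) (g j)) :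
    Nonempty (Iso M N) := by
  let F := Finsupp.linearCombination ℂ f
  let G := Finsupp.linearCombination ℂ g
  have dF : DenseRange F := by
    rw [← Finsupp.range_linearCombination] at hf
    exact hf
  have dG : DenseRange G := by
    rw [← Finsupp.range_linearCombination] at hg
    exact hg
  have hrr : ∀ x y, M.toPre.rinner (F x) (F y) = N.toPre.rinner (G x) (G y) := by
    intro x y
    induction x using Finsupp.induction_linear with
    | zero => simp
    | add x x' hx hx' => simp only [map_add, LinearMap.add_apply, hx, hx']
    | single i c =>
    induction y using Finsupp.induction_linear with
    | zero => simp
    | add x x' hx hx' => simp only [map_add, hx, hx']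
    | single j d => simp [F, G, hr]
  have hll : ∀ x y, M.toPre.linner (F x) (F y) = N.toPre.linner (G x) (G y) := by
    intro x y
    induction x using Finsupp.induction_linear with
    | zero => simp
    | add x x' hx hx' => simp only [map_add, LinearMap.add_apply, hx, hx']
    | single i c =>
    induction y using Finsupp.induction_linear with
    | zero => simp
    | add x x' hx hx' => simp only [map_add, hx, hx']
    | single j d => simp [F, G, hl]
  obtain ⟨c, hc, C, hC, h1⟩ := M.rnorm_equiv
  obtain ⟨c', hc', C', hC', h2⟩ := N.rnorm_equiv
  have b1 : ∃ K, ∀ x, ‖G x‖ ≤ K * ‖F x‖ := ⟨c'⁻¹ * C, fun x => by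
    rw [mul_assoc, le_inv_mul_iff₀ hc']
    refine (h2 _).1.trans ?_
    rw [← hrr]
    exact (h1 _).2⟩
  have b2 : ∃ K, ∀ x, ‖F x‖ ≤ K * ‖G x‖ := ⟨c⁻¹ * C', fun x => by
    rw [mul_assoc, le_inv_mul_iff₀ hc]
    refine (h1 _).1.trans ?_
    rw [hrr]
    exact (h2 _).2⟩
  let U : M.carrier ≃L[ℂ] N.carrier :=
    (LinearEquiv.refl ℂ (ι →₀ ℂ)).extend F G dF b1 dG b2
  have hU : ∀ x, U (F x) = G x := fun x => LinearEquiv.extend_eq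
    (LinearEquiv.refl ℂ (ι →₀ ℂ)) F G dF b1 dG b2 x
  have Ur : ∀ x y, N.toPre.rinner (U x) (U y) = M.toPre.rinner x y := by
    intro x y
    induction x, y using dF.induction_on₂ with
    | hp =>
      exact isClosed_eq (N.continuous_rinner.comp (f := fun q : M.carrier × M.carrier =>
        (U q.1, U q.2)) (by fun_prop)) M.continuous_rinner
    | h x y => rw [hU, hU, hrr]
  have Ul : ∀ x y, N.toPre.linner (U x) (U y) = M.toPre.linner x y := by
    intro x y
    induction x, y using dF.induction_on₂ with
    | hp =>
      exact isClosed_eq (N.continuous_linner.comp (f := fun q : M.carrier × M.carrier =>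
        (U q.1, U q.2)) (by fun_prop)) M.continuous_linner
    | h x y => rw [hU, hU, hll]
  refine ⟨⟨U, fun a x => ?_, fun b x => ?_, Ul, Ur⟩⟩
  · rw [← sub_eq_zero]
    refine N.linner_definite _ ?_
    set z := U (M.toPre.lsmul a x) - N.toPre.lsmul a (U x)
    obtain ⟨y, hy⟩ := U.surjective z
    rw [← hy]
    nth_rewrite 1 [hy]
    simp only [z, map_sub, LinearMap.sub_apply, Ul, PreHilbertBimodule.linner_lsmul, sub_self]
  · rw [← sub_eq_zero]
    refine N.rinner_definite _ ?_
    set z := U (M.toPre.rsmul b x) - N.toPre.rsmul b (U x)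
    obtain ⟨y, hy⟩ := U.surjective z
    rw [← hy]
    nth_rewrite 2 [hy]
    simp only [z, map_sub, Ur, PreHilbertBimodule.rinner_rsmul, sub_self]

lemma Iso.tensor {M M' : HilbertBimodule A B} {N N' : HilbertBimodule B C} (U : Iso M M')
    (V : Iso N N') : Nonempty (Iso (M.tensor N) (M'.tensor N')) := by
  refine nonempty_iso (fun x : M.carrier × N.carrier => M.tmul N x.1 x.2)
    (fun x => M'.tmul N' (U.toEquiv x.1) (V.toEquiv x.2)) (M.dense_tmul N) ?_ ?_ ?_
  · have h : (Set.range fun x : M.carrier × N.carrier => M'.tmul N' (U.toEquiv x.1)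
        (V.toEquiv x.2)) = Set.range fun x : M'.carrier × N'.carrier => M'.tmul N' x.1 x.2 :=
      (U.toEquiv.surjective.prodMap V.toEquiv.surjective).range_comp
        (fun x : M'.carrier × N'.carrier => M'.tmul N' x.1 x.2)
    rw [h]
    exact M'.dense_tmul N'
  · intro i j
    simp only [linner_tmul, V.map_linner, ← U.map_rsmul, U.map_linner]
  · intro i j
    simp only [rinner_tmul, U.map_rinner, ← V.map_lsmul, V.map_rinner]

lemma dense_bilin {E F G ι : Type*} [NormedAddCommGroup E] [NormedSpace ℂ E]
    [NormedAddCommGroup F] [NormedSpace ℂ F] [NormedAddCommGroup G] [NormedSpace ℂ G]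
    (β : E →ₗ[ℂ] F →ₗ[ℂ] G) (hc : ∀ y, Continuous fun x => β x y) (s : ι → E)
    (hs : Dense (Submodule.span ℂ (Set.range s) : Set E))
    (hβ : Dense (Submodule.span ℂ (Set.range fun x : E × F => β x.1 x.2) : Set G)) :
    Dense (Submodule.span ℂ (Set.range fun x : ι × F => β (s x.1) x.2) : Set G) := by
  rw [Submodule.dense_iff_topologicalClosure_eq_top, eq_top_iff,
    ← Submodule.dense_iff_topologicalClosure_eq_top.mp hβ]
  refine Submodule.topologicalClosure_minimal _ (Submodule.span_le.mpr ?_)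
    (Submodule.isClosed_topologicalClosure _)
  rintro _ ⟨⟨x, y⟩, rfl⟩
  refine hs.induction (P := fun x => β x y ∈ (Submodule.span ℂ
    (Set.range fun x : ι × F => β (s x.1) x.2)).topologicalClosure) ?_
    ((Submodule.isClosed_topologicalClosure _).preimage (hc y)) x
  intro t ht
  refine Submodule.le_topologicalClosure _ ?_
  induction ht using Submodule.span_induction with
  | mem t ht =>
    obtain ⟨i, rfl⟩ := ht
    exact Submodule.subset_span ⟨(i, y), rfl⟩
  | zero => simp
  | add x y _ _ hx hy =>
    simp only [map_add, LinearMap.add_apply]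
    exact Submodule.add_mem _ hx hy
  | smul c x _ hx =>
    simp only [map_smul, LinearMap.smul_apply]
    exact Submodule.smul_mem _ c hx

lemma dense_tmul_tmul (M : HilbertBimodule A B) (N : HilbertBimodule B C)
    (P : HilbertBimodule C D) : Dense (Submodule.span ℂ (Set.range
      fun x : (M.carrier × N.carrier) × P.carrier =>
        (M.tensor N).tmul P (M.tmul N x.1.1 x.1.2) x.2) :
      Set ((M.tensor N).tensor P).carrier) :=
  dense_bilin ((M.tensor N).tmul P)
    (fun y => ((M.tensor N).continuous_tmul P).comp (.prodMk_left y))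
    (fun x : M.carrier × N.carrier => M.tmul N x.1 x.2) (M.dense_tmul N)
    ((M.tensor N).dense_tmul P)

lemma dense_tmul_tmul' (M : HilbertBimodule A B) (N : HilbertBimodule B C)
    (P : HilbertBimodule C D) : Dense (Submodule.span ℂ (Set.range
      fun x : (M.carrier × N.carrier) × P.carrier =>
        M.tmul (N.tensor P) x.1.1 (N.tmul P x.1.2 x.2)) :
      Set (M.tensor (N.tensor P)).carrier) := by
  have h1 : Dense (Submodule.span ℂ (Set.range fun x : (N.tensor P).carrier × M.carrier =>
      (M.tmul (N.tensor P)).flip x.1 x.2) : Set (M.tensor (N.tensor P)).carrier) := by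
    have h := M.dense_tmul (N.tensor P)
    rwa [← (Equiv.prodComm _ _).surjective.range_comp] at h
  have h2 := dense_bilin (M.tmul (N.tensor P)).flip
    (fun m => (M.continuous_tmul (N.tensor P)).comp (.prodMk_right m))
    (fun x : N.carrier × P.carrier => N.tmul P x.1 x.2) (N.dense_tmul P) h1
  let σ : (M.carrier × N.carrier) × P.carrier → (N.carrier × P.carrier) × M.carrier :=
    fun x => ((x.1.2, x.2), x.1.1)
  have hσ : Function.Surjective σ := fun y => ⟨((y.2, y.1.1), y.1.2), rfl⟩
  rwa [← hσ.range_comp] at h2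

lemma tensor_assoc (M : HilbertBimodule A B) (N : HilbertBimodule B C)
    (P : HilbertBimodule C D) :
    Nonempty (Iso ((M.tensor N).tensor P) (M.tensor (N.tensor P))) := by
  refine nonempty_iso _ _ (dense_tmul_tmul M N P) (dense_tmul_tmul' M N P) ?_ ?_
  · intro i j
    simp only [linner_tmul, rsmul_tmul]
  · intro i j
    simp only [rinner_tmul, lsmul_tmul]

lemma dense_of_surjective {E ι : Type*} [NormedAddCommGroup E] [NormedSpace ℂ E] {f : ι → E}
    (hf : Function.Surjective f) : Dense (Submodule.span ℂ (Set.range f) : Set E) := by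
  rw [hf.range_eq, Submodule.span_univ]
  exact dense_univ

/-- An isomorphism induces an isomorphism of the duals. -/
lemma Iso.dual {M M' : HilbertBimodule A B} (U : Iso M M') : Nonempty (Iso M.dual M'.dual) :=
  nonempty_iso (M := M.dual) (N := M'.dual) (fun x : M.carrier => x) U.toEquiv
    (dense_of_surjective Function.surjective_id) (dense_of_surjective U.toEquiv.surjective)
    (fun i j => (U.map_rinner i j).symm) (fun i j => (U.map_linner i j).symm)

instance isoSetoid (A B : Type u) [NonUnitalCStarAlgebra A] [NonUnitalCStarAlgebra B] :
    Setoid (HilbertBimodule A B) where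
  r M N := Nonempty (Iso M N)
  iseqv := ⟨fun M => ⟨.refl M⟩, fun ⟨U⟩ => ⟨U.symm⟩, fun ⟨U⟩ ⟨V⟩ => ⟨U.trans V⟩⟩

/-- `M` is full: the inner products span dense subspaces of `A` and of `B`. Full bimodules are the
`A`-`B`-imprimitivity bimodules. -/
def IsFull (M : HilbertBimodule A B) : Prop :=
  Dense (Submodule.span ℂ {a | ∃ x y, a = M.toPre.linner x y} : Set A) ∧
  Dense (Submodule.span ℂ {b | ∃ x y, b = M.toPre.rinner x y} : Set B)

end HilbertBimodule

/-- Strong Morita equivalence: there is an `A`-`B`-imprimitivity bimodule. -/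
def StronglyMoritaEquivalent (A B : Type u) [NonUnitalCStarAlgebra A]
    [NonUnitalCStarAlgebra B] : Prop :=
  ∃ M : HilbertBimodule A B, M.IsFull

/-- `S(A)`: the isomorphism classes of associative Hilbert C*-bimodules over `A`. -/
def BimoduleSemigroup (A : Type u) [NonUnitalCStarAlgebra A] : Type (u + 1) :=
  Quotient (HilbertBimodule.isoSetoid A A)

namespace BimoduleSemigroup

variable {A : Type u} [NonUnitalCStarAlgebra A]

/-- The isomorphism class of a bimodule. -/
def mk (M : HilbertBimodule A A) : BimoduleSemigroup A := Quotient.mk _ M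

/-- The product of classes is the class of the interior tensor product. -/
noncomputable instance : Semigroup (BimoduleSemigroup A) where
  mul := Quotient.map₂ HilbertBimodule.tensor fun _ _ ⟨U⟩ _ _ ⟨V⟩ => U.tensor V
  mul_assoc := by
    rintro ⟨M⟩ ⟨N⟩ ⟨P⟩
    exact Quotient.sound (HilbertBimodule.tensor_assoc M N P)

/-- The class of the dual bimodule, which is the inverse in the inverse semigroup `S(A)`. -/
noncomputable instance : Inv (BimoduleSemigroup A) where
  inv := Quotient.map HilbertBimodule.dual fun _ _ ⟨U⟩ => U.dual

lemma mk_mul_mk (M N : HilbertBimodule A A) : mk M * mk N = mk (M.tensor N) := rfl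

lemma inv_mk (M : HilbertBimodule A A) : (mk M)⁻¹ = mk M.dual := rfl

end BimoduleSemigroup

/-! Write `m` for the class of an imprimitivity bimodule `M`, `m*` for that of its dual, and
juxtaposition for the interior tensor product. Conjugation `x ↦ m* x m` is an isomorphism for the
same reason as in a group: `m m*` and `m* m` act as units, so `(m* x m)(m* y m) = m* x (m m*) y m =
m* x y m`, and conjugation by `m*` undoes conjugation by `m`. It respects duals because `(m* x m)* =
m* x* m`.

The analytic content is the left unit law `IsFull.tensor_dual_tensor`. The assignment `m ⊗ n~ ⊗ q ↦
⟨m, n⟩_A q` preserves both inner products, by associativity in `M` and adjointability of the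
actions. Its values span a dense subspace of `Q`, because the values of the form of `M` span a dense
subspace of `A` and `A` acts nondegenerately on `Q`. By `nonempty_iso`, two dense families with
equal left and right Gram matrices already determine an isomorphism of bimodules, so no map has to
be shown well defined, linear or equivariant.

The other unit laws follow from this one by duality. Fullness passes to `M*`, and `M** ≅ M`, so the
law for `M*` gives that of `M* ⊗ M`. The isomorphism `(M ⊗ N)* ≅ N* ⊗ M*` turns left unit laws into
right ones. All unit laws are stated as cancellations such as `m (m* y) = y`; the bimodule `A` over
itself is therefore never needed as an identity element, and everything after the first part is
algebra in a family of classes with an associative product and an involution. -/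

namespace HilbertBimodule

/-! ### Continuity of the action, and duals of duals and of tensor products -/

variable {A B C : Type u} [NonUnitalCStarAlgebra A] [NonUnitalCStarAlgebra B]
  [NonUnitalCStarAlgebra C]

/-- Boundedness of the action is not an axiom; it comes from `‖⟨a x, a x⟩‖ ≤ ‖a‖² ‖⟨x, x⟩‖` and the
equivalence of norms. It serves to pass from all of `A` to a subset with dense span in
`dense_linner_lsmul`. -/
lemma continuous_lsmul_left (M : HilbertBimodule A B) (x : M.carrier) :
    Continuous fun a => M.toPre.lsmul a x := by
  obtain ⟨c, hc, K, -, h⟩ := M.lnorm_equiv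
  refine ((M.toPre.lsmul.flip x).mkContinuous (c⁻¹ * √‖M.toPre.linner x x‖) fun a => ?_).continuous
  rw [mul_assoc, le_inv_mul_iff₀ hc]
  refine (h _).1.trans (Real.sqrt_le_iff.mpr ⟨by positivity, ?_⟩)
  rw [mul_pow, Real.sq_sqrt (norm_nonneg _), mul_comm]
  exact M.toPre.norm_linner_lsmul a x

lemma IsFull.dual {M : HilbertBimodule A B} (hM : M.IsFull) : M.dual.IsFull := ⟨hM.2, hM.1⟩

/-- The double dual of `M` is `M`. -/
lemma dual_dual (M : HilbertBimodule A B) : Nonempty (Iso M.dual.dual M) :=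
  -- Both families consist of all elements, indexed by themselves, and dualising twice returns each
  -- form to its place. Only forms are compared, so linearity of the identity map from the double
  -- conjugate space needs no check.
  nonempty_iso (M := M.dual.dual) (fun x : M.carrier => x) (fun x => x)
    (dense_of_surjective Function.surjective_id) (dense_of_surjective Function.surjective_id)
    (fun _ _ => rfl) (fun _ _ => rfl)

/-- A subspace is stable under `c` exactly when it is stable under `conj c`, so conjugating the
scalars does not change a span as a set. One inclusion is enough, since a set containing a dense set
is dense. -/
lemma dense_span_conj {E ι : Type u} [NormedAddCommGroup E] [NormedSpace ℂ E] {f : ι → E}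
    (hf : Dense (Submodule.span ℂ (Set.range f) : Set E)) :
    Dense (Submodule.span ℂ (Set.range fun i => ConjSpace.toConj (f i)) : Set (ConjSpace E)) := by
  have h : (Submodule.span ℂ (Set.range f) : Set E) ⊆
      (fun x => (ConjSpace.toConj x : ConjSpace E)) ⁻¹'
      (Submodule.span ℂ (Set.range fun i => ConjSpace.toConj (f i)) : Set (ConjSpace E)) := by
    intro x hx
    induction hx using Submodule.span_induction with
    | mem x hx =>
      obtain ⟨i, rfl⟩ := hx
      exact Submodule.subset_span (R := ℂ) (M := ConjSpace E) ⟨i, rfl⟩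
    | zero => simp
    | add x y _ _ hx hy =>
      change ConjSpace.toConj (x + y) ∈ _
      rw [map_add]
      exact Submodule.add_mem _ hx hy
    | smul c x _ hx =>
      change ConjSpace.toConj (c • x) ∈ _
      rw [ConjSpace.toConj_smul]
      exact Submodule.smul_mem _ _ hx
  -- `ConjSpace E` has the underlying set and the topology of `E`, so density in one is density in
  -- the other by definition.
  exact hf.mono h

/-- The dual of `M ⊗ N` is `N* ⊗ M*`. -/
lemma dual_tensor (M : HilbertBimodule A B) (N : HilbertBimodule B C) :
    Nonempty (Iso (M.tensor N).dual (N.dual.tensor M.dual)) := by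
  -- The elementary tensors `n~ ⊗ m~` are indexed with the factor from `M` first, so that they share
  -- the index set of the family `(m ⊗ n)~`.
  have hd : Dense (Submodule.span ℂ (Set.range fun x : M.dual.carrier × N.dual.carrier =>
      N.dual.tmul M.dual x.2 x.1) : Set (N.dual.tensor M.dual).carrier) := by
    have h := N.dual.dense_tmul M.dual
    rwa [← (Equiv.prodComm _ _).surjective.range_comp] at h
  -- The right form of `M ⊗ N` is the left form of its dual. The right-hand side is the left form of
  -- `N* ⊗ M*` on `n~ ⊗ m~` and `n'~ ⊗ m'~` after unfolding `n~ b = (b* n)~`; hence the `star`. The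
  -- roles of left and right are exchanged in `hr`.
  have hl : ∀ (m m' : M.carrier) (n n' : N.carrier),
      (M.tensor N).toPre.rinner (M.tmul N m n) (M.tmul N m' n') =
        N.toPre.rinner (N.toPre.lsmul (star (M.toPre.rinner m m')) n) n' := by
    intro m m' n n'
    rw [rinner_tmul, N.toPre.rinner_lsmul, star_star]
  have hr : ∀ (m m' : M.carrier) (n n' : N.carrier),
      (M.tensor N).toPre.linner (M.tmul N m n) (M.tmul N m' n') =
        M.toPre.linner m (M.toPre.rsmul (star (N.toPre.linner n n')) m') := by
    intro m m' n n'
    rw [linner_tmul, M.toPre.linner_rsmul]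
  let f : M.carrier × N.carrier → ConjSpace (M.tensor N).carrier :=
    fun x => ConjSpace.toConj (M.tmul N x.1 x.2)
  exact nonempty_iso (M := (M.tensor N).dual) f _
    (dense_span_conj (M.dense_tmul N)) hd
    (fun i j => (hl i.1 j.1 i.2 j.2).trans (N.dual.linner_tmul M.dual i.2 j.2 i.1 j.1).symm)
    (fun i j => (hr i.1 j.1 i.2 j.2).trans (N.dual.rinner_tmul M.dual i.2 j.2 i.1 j.1).symm)

/-! ### The left unit law for `M ⊗ M*` -/

/-- Nondegeneracy makes the products `a q` span a dense subspace, and for fixed `q` continuity in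
`a` allows `a` to run only over the values of the form of `M`, whose span is dense in `A`. This is
where fullness enters, and only through its half concerning `A`; the half concerning `B` is reached
by applying the result to `M*`. -/
lemma dense_linner_lsmul {M : HilbertBimodule A B} (hM : M.IsFull) (Q : HilbertBimodule A C) :
    Dense (Submodule.span ℂ (Set.range fun x : (M.carrier × M.carrier) × Q.carrier =>
      Q.toPre.lsmul (M.toPre.linner x.1.1 x.1.2) x.2) : Set Q.carrier) := by
  refine dense_bilin Q.toPre.lsmul Q.continuous_lsmul_left
    (fun x : M.carrier × M.carrier => M.toPre.linner x.1 x.2) ?_ ?_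
  · have h : (Set.range fun x : M.carrier × M.carrier => M.toPre.linner x.1 x.2) =
        {a | ∃ x y, a = M.toPre.linner x y} := by
      ext a
      simp [eq_comm]
    rw [h]
    exact hM.1
  · have h : (Set.range fun x : A × Q.carrier => Q.toPre.lsmul x.1 x.2) =
        {z | ∃ a x, z = Q.toPre.lsmul a x} := by
      ext z
      simp [eq_comm]
    rw [h]
    exact Q.dense_lsmul

/-- If `M` is full, then `M ⊗ M*` is a left unit for the interior tensor product. -/
lemma IsFull.tensor_dual_tensor {M : HilbertBimodule A B} (hM : M.IsFull)
    (Q : HilbertBimodule A C) : Nonempty (Iso ((M.tensor M.dual).tensor Q) Q) := by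
  -- The left form of `(M ⊗ M*) ⊗ Q` on elementary tensors, with the dual unfolded, against that of
  -- their images `⟨m, n⟩_A q`. Associativity splits it as `⟨m, a* n⟩⟨n', m'⟩` with `a = ⟨q, q'⟩`,
  -- which is `⟨m, n⟩ a ⟨m', n'⟩*`.
  have hl : ∀ (m n m' n' : M.carrier) (q q' : Q.carrier),
      M.toPre.linner (M.toPre.rsmul (M.toPre.rinner
        (M.toPre.lsmul (star (Q.toPre.linner q q')) n) n') m) m' =
      Q.toPre.linner (Q.toPre.lsmul (M.toPre.linner m n) q)
        (Q.toPre.lsmul (M.toPre.linner m' n') q') := by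
    intro m n m' n' q q'
    rw [M.weakAssoc.2, M.toPre.linner_lsmul_right, star_star, Q.toPre.linner_lsmul,
      Q.toPre.linner_lsmul_right, M.toPre.star_linner, mul_assoc]
  -- The same comparison for the right forms: `⟨n⟨m, m'⟩, n'⟩ = ⟨n, m⟩⟨m', n'⟩`, and the factor `⟨n,
  -- m⟩ = ⟨m, n⟩*` moves to the other side of the form of `Q` as an adjoint.
  have hr : ∀ (m n m' n' : M.carrier) (q q' : Q.carrier),
      Q.toPre.rinner q (Q.toPre.lsmul (M.toPre.linner n
        (M.toPre.rsmul (star (M.toPre.rinner m m')) n')) q') =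
      Q.toPre.rinner (Q.toPre.lsmul (M.toPre.linner m n) q)
        (Q.toPre.lsmul (M.toPre.linner m' n') q') := by
    intro m n m' n' q q'
    rw [← M.toPre.linner_rsmul, M.weakAssoc.2, Q.toPre.mul_lsmul, Q.toPre.rinner_lsmul,
      M.toPre.star_linner]
  refine nonempty_iso _ _ (dense_tmul_tmul M M.dual Q) (dense_linner_lsmul hM Q) ?_ ?_
  · intro i j
    rw [linner_tmul, rsmul_tmul, linner_tmul]
    exact hl _ _ _ _ _ _
  · intro i j
    rw [rinner_tmul, rinner_tmul]
    exact hr _ _ _ _ _ _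

end HilbertBimodule

/-! ### Algebra of isomorphism classes over varying algebras -/

/-- The isomorphism classes of associative Hilbert C*-bimodules, left over `A` and right
over `B`. -/
def BimoduleClass (A B : Type u) [NonUnitalCStarAlgebra A] [NonUnitalCStarAlgebra B] :
    Type (u + 1) :=
  Quotient (HilbertBimodule.isoSetoid A B)

namespace BimoduleClass

variable {A B C D : Type u} [NonUnitalCStarAlgebra A] [NonUnitalCStarAlgebra B]
  [NonUnitalCStarAlgebra C] [NonUnitalCStarAlgebra D]

/-- The isomorphism class of a bimodule. -/
def mk (M : HilbertBimodule A B) : BimoduleClass A B := Quotient.mk _ M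

/-- The class of the interior tensor product. -/
noncomputable def comp : BimoduleClass A B → BimoduleClass B C → BimoduleClass A C :=
  Quotient.map₂ HilbertBimodule.tensor fun _ _ ⟨U⟩ _ _ ⟨V⟩ => U.tensor V

/-- The class of the dual bimodule. -/
noncomputable def dual : BimoduleClass A B → BimoduleClass B A :=
  Quotient.map HilbertBimodule.dual fun _ _ ⟨U⟩ => U.dual

lemma comp_assoc (x : BimoduleClass A B) (y : BimoduleClass B C) (z : BimoduleClass C D) :
    (x.comp y).comp z = x.comp (y.comp z) := by
  obtain ⟨M⟩ := x
  obtain ⟨N⟩ := y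
  obtain ⟨P⟩ := z
  exact Quotient.sound (HilbertBimodule.tensor_assoc M N P)

lemma dual_dual (x : BimoduleClass A B) : x.dual.dual = x := by
  obtain ⟨M⟩ := x
  exact Quotient.sound M.dual_dual

lemma dual_comp (x : BimoduleClass A B) (y : BimoduleClass B C) :
    (x.comp y).dual = y.dual.comp x.dual := by
  obtain ⟨M⟩ := x
  obtain ⟨N⟩ := y
  exact Quotient.sound (M.dual_tensor N)

/-- A class of imprimitivity bimodules. -/
def IsFull (x : BimoduleClass A B) : Prop := ∃ M : HilbertBimodule A B, M.IsFull ∧ mk M = x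

/-- Dualising swaps the two density conditions. A class is full as soon as one representative is, so
a representative suffices and invariance of fullness under isomorphism is not needed. -/
lemma IsFull.dual {x : BimoduleClass A B} (hx : x.IsFull) : x.dual.IsFull := by
  obtain ⟨M, hM, rfl⟩ := hx
  exact ⟨M.dual, hM.dual, rfl⟩

/-- The left unit law in cancelled form, bracketed as it occurs in a product associated to the
right. The freedom of `C` matters: in `IsFull.conjugate_comp` the factor `y` is itself a product
ending in an `A`-`B`-class. -/
lemma IsFull.comp_dual_comp {x : BimoduleClass A B} (hx : x.IsFull) (y : BimoduleClass A C) :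
    x.comp (x.dual.comp y) = y := by
  obtain ⟨M, hM, rfl⟩ := hx
  rw [← comp_assoc]
  obtain ⟨Q⟩ := y
  exact Quotient.sound (hM.tensor_dual_tensor Q)

lemma IsFull.dual_comp_comp {x : BimoduleClass A B} (hx : x.IsFull) (y : BimoduleClass B C) :
    x.dual.comp (x.comp y) = y := by
  simpa only [dual_dual] using hx.dual.comp_dual_comp y

/-- The dual reverses products and fixes `x x*`, so the right unit law for `y` is the left unit law
for `y*`. -/
lemma IsFull.comp_comp_dual {x : BimoduleClass A B} (hx : x.IsFull) (y : BimoduleClass C A) :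
    y.comp (x.comp x.dual) = y := by
  rw [← dual_dual (y.comp _), dual_comp, dual_comp x, dual_dual x, comp_assoc, hx.comp_dual_comp,
    dual_dual]

lemma IsFull.comp_dual_comp_self {x : BimoduleClass A B} (hx : x.IsFull)
    (y : BimoduleClass C B) : y.comp (x.dual.comp x) = y := by
  simpa only [dual_dual] using hx.dual.comp_comp_dual y

/-- The class of `M* ⊗ Q ⊗ M`. -/
noncomputable def conjugate (m : BimoduleClass A B) (x : BimoduleClass A A) : BimoduleClass B B :=
  (m.dual.comp x).comp m

/-- The dual of `m* x m` is `m* x* m**`, and `m** = m`. Nothing is cancelled, so `m` may be any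
class. -/
lemma conjugate_dual (m : BimoduleClass A B) (x : BimoduleClass A A) :
    m.conjugate x.dual = (m.conjugate x).dual := by
  rw [conjugate, conjugate, dual_comp, dual_comp, dual_dual, comp_assoc]

/-- With all brackets to the right, the product of the conjugates contains `m (m* (y m))` after `x`,
which cancels to `y m`. -/
lemma IsFull.conjugate_comp {m : BimoduleClass A B} (hm : m.IsFull) (x y : BimoduleClass A A) :
    m.conjugate (x.comp y) = (m.conjugate x).comp (m.conjugate y) := by
  simp only [conjugate, comp_assoc, hm.comp_dual_comp]

lemma IsFull.conjugate_conjugate_dual {m : BimoduleClass A B} (hm : m.IsFull) (y : BimoduleClass B B) :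
    m.conjugate (m.dual.conjugate y) = y := by
  -- Reassociation gives `m* (m (y (m* m)))`; the inner factor `m* m` cancels on the right of `y`,
  -- then `m* m` on its left.
  rw [conjugate, conjugate, dual_dual, comp_assoc, comp_assoc, comp_assoc, hm.comp_dual_comp_self,
    hm.dual_comp_comp]

lemma IsFull.conjugate_dual_conjugate {m : BimoduleClass A B} (hm : m.IsFull) (x : BimoduleClass A A) :
    m.dual.conjugate (m.conjugate x) = x := by
  simpa only [dual_dual] using hm.dual.conjugate_conjugate_dual x

end BimoduleClass

/-! ### The isomorphism of semigroups -/

/-- The isomorphism `[Q] ↦ [M* ⊗ Q ⊗ M]` given by a class of imprimitivity bimodules. -/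
noncomputable def BimoduleSemigroup.conjEquiv {A B : Type u} [NonUnitalCStarAlgebra A]
    [NonUnitalCStarAlgebra B] {m : BimoduleClass A B} (hm : m.IsFull) :
    BimoduleSemigroup A ≃* BimoduleSemigroup B where
  -- `BimoduleSemigroup A` and `BimoduleClass A A` unfold to the same quotient, with `comp` as
  -- product and `dual` as inverse, so the identities between classes apply as they stand.
  toFun := m.conjugate
  invFun := m.dual.conjugate
  left_inv := hm.conjugate_dual_conjugate
  right_inv := hm.conjugate_conjugate_dual
  map_mul' := hm.conjugate_comp

theorem mainTheorem7 {A B : Type u} [NonUnitalCStarAlgebra A] [NonUnitalCStarAlgebra B]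
    (hAB : StronglyMoritaEquivalent A B) :
    Nonempty (BimoduleSemigroup A ≃* BimoduleSemigroup B) ∧
    ∀ M : HilbertBimodule A B, M.IsFull →
      ∃ Φ : BimoduleSemigroup A ≃* BimoduleSemigroup B,
        (∀ Q : HilbertBimodule A A, Φ (BimoduleSemigroup.mk Q) =
          BimoduleSemigroup.mk ((M.dual.tensor Q).tensor M)) ∧
        (∀ P : HilbertBimodule B B, Φ.symm (BimoduleSemigroup.mk P) =
          BimoduleSemigroup.mk ((M.tensor P).tensor M.dual)) ∧
        ∀ s, Φ s⁻¹ = (Φ s)⁻¹ := by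
  refine ⟨?_, fun M hM => ?_⟩
  · obtain ⟨M, hM⟩ := hAB
    exact ⟨BimoduleSemigroup.conjEquiv ⟨M, hM, rfl⟩⟩
  · have hm : (BimoduleClass.mk M).IsFull := ⟨M, hM, rfl⟩
    refine ⟨BimoduleSemigroup.conjEquiv hm, fun _ => rfl, fun P => ?_,
      (BimoduleClass.mk M).conjugate_dual⟩
    -- The inverse map is conjugation by `m*`, which sends `[P]` to `m** [P] m*`. The forward
    -- formula holds by definition, but here `m**` has to be replaced by `m`.
    exact congrArg (fun m => (m.comp (BimoduleClass.mk P)).comp (BimoduleClass.mk M).dual)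
      (BimoduleClass.dual_dual (BimoduleClass.mk M))
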